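/- Optimality of squeezing plus homodyne detection for estimating one displacement coordinate. Setting. Consider one bosonic mode with $\hat q,\hat p$, $[\hat q,\hat p]=i$, $\hat a=(\hat q+i\hat p)/\sqrt2$, displacement operators $\hat D(\alpha)=\exp(\alpha\hat a^\dagger-\alpha^*\hat a)$ and squeezing operators $\hat S(r)=\exp[\tfrac r2(\hat a^2-\hat a^{\dagger 2})]$ ($r\in\mathbb R$). A Gaussian state is a density operator whose Wigner function is $W(\mathbf x)=\exp[-(\mathbf x-\bar{\mathbf x})^T\Gamma^{-1}(\mathbf x-\bar{\mathbf x})]/(\pi\sqrt{\det\Gamma})$; it has squeezing strength $r$, squeezing angle $\varphi$ and thermal occupation $n\ge 0$ (pure iff $n=0$) if $$\Gamma=(2n+1)\begin{pmatrix}\cosh 2r-\cos\varphi\,\sinh 2r&\sin\varphi\,\sinh 2r\\ \sin\varphi\,\sinh 2r&\cosh 2r+\cos\varphi\,\sinh 2r\end{pmatrix}.$$ The unknown displacement $\alpha=\alpha_{\mathrm R}+i\alpha_{\mathrm I}$ acts on a probe $\rho$ as $\rho(\alpha)=\hat D(\alpha)\rho\hat D(\alpha)^\dagger$. The prior of $\alpha_{\mathrm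 R}$ is $\mathcal N(\mu_0,\sigma_0^2)$ with $\sigma_0>0$, and $\alpha_{\mathrm I}$ is independent of $\alpha_{\mathrm R}$ with an arbitrary law $\tau$ (e.g. $\mathcal N(\nu_0,\sigma_0^2)$, which gives the isotropic Gaussian prior on $\mathbb C$, or a point mass, which gives a single-parameter problem). For a POVM $E$ the likelihood is $P(A\mid\alpha)=\mathrm{Tr}[E(A)\rho(\alpha)]$, and $\bar V_{\mathrm{post}}^{\hat q}$ denotes the average over the measurement outcomes of the variance of $\alpha_{\mathrm R}$ under the posterior distribution given by Bayes' law. Theorem. Let $r\in\mathbb R$. (i) Lower bound. For every POVM, with outcomes in any measurable space, and every single-mode Gaussian probe state (pure or mixed, with arbitrary first moments) with squeezing strength $r$ and squeezing angle $\varphi$, where $r\ge 0$ or $\varphi=0$, $$\bar V_{\mathrm{post}}^{\hat q}\ \ge\ \Bigl(\frac1{\sigma_0^2}+4e^{2r}\Bigr)^{-1}.$$ (ii) Attainment. The squeezed vacuum $\hat S(r)|0\rangle$ is a Gaussian state with $\bar{\mathbf x}=0$, squeezing strength $r$, $\varphi=0$ and $n=0$, and with homodyne detection of $\hat q$, i.e.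 the POVM $\{|q\rangle\langle q|\}_{q\in\mathbb R}$, it achieves $$\bar V_{\mathrm{post}}^{\hat q}=\Bigl(\frac1{\sigma_0^2}+4e^{2r}\Bigr)^{-1}.$$ Hence squeezed vacuum with homodyne detection along the same direction is an optimal strategy. -/

import Mathlib

open MeasureTheory ProbabilityTheory
open scoped ENNReal NNReal InnerProductSpace ComplexInnerProductSpace

noncomputable section

namespace BosonicMode

/-! ### The Hilbert space of one bosonic mode and the basic unitaries

One mode is taken in the Schrödinger (position) representation: the Hilbert space is `L²(ℝ; ℂ)`,
the quadrature `q̂` is multiplication by the coordinate, `p̂ = -i d/dx` and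
`â = (q̂ + i p̂) / √2`, so that `[q̂, p̂] = i` and `[â, â†] = 1`. -/

/-- The Hilbert space `L²(ℝ; ℂ)` of a single bosonic mode. -/
abbrev Mode : Type := Lp ℂ 2 (volume : Measure ℝ)

lemma map_affine_volume {a : ℝ} (ha : a ≠ 0) (b : ℝ) :
    Measure.map (fun x : ℝ => a * x + b) volume = ENNReal.ofReal |a⁻¹| • volume := by
  have h1 : (fun x : ℝ => a * x + b) = (fun y => y + b) ∘ (fun x => a * x) := rfl
  rw [h1, ← Measure.map_map (by fun_prop) (by fun_prop), Real.map_volume_mul_left ha,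
    Measure.map_smul, map_add_right_eq_self]

lemma quasiMeasurePreserving_affine {a : ℝ} (ha : a ≠ 0) (b : ℝ) :
    Measure.QuasiMeasurePreserving (fun x : ℝ => a * x + b) volume volume :=
  ⟨by fun_prop, by
    rw [map_affine_volume ha b]
    exact Measure.smul_absolutelyContinuous⟩

lemma eLpNorm_affineComp {a : ℝ} (ha : a ≠ 0) (b : ℝ) {u : ℝ → ℂ}
    (hn : ∀ x, ‖u x‖ = √|a|) {f : ℝ → ℂ} (hf : AEStronglyMeasurable f volume) :
    eLpNorm (fun x => u x * f (a * x + b)) 2 volume = eLpNorm f 2 volume := by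
  have h1 : eLpNorm (fun x => u x * f (a * x + b)) 2 volume
      = eLpNorm ((√|a|) • (f ∘ fun x : ℝ => a * x + b)) 2 volume := by
    refine eLpNorm_congr_norm_ae (Filter.Eventually.of_forall fun x => ?_)
    simp [hn x, abs_of_nonneg (Real.sqrt_nonneg _)]
  have hf' : AEStronglyMeasurable f (Measure.map (fun x : ℝ => a * x + b) volume) :=
    hf.mono_ac (quasiMeasurePreserving_affine ha b).2
  rw [h1, eLpNorm_const_smul, ← eLpNorm_map_measure hf' (by fun_prop), map_affine_volume ha b,
    eLpNorm_smul_measure_of_ne_top (by simp)]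
  have h2 : ‖√|a|‖ₑ = ENNReal.ofReal (√|a|) := Real.enorm_of_nonneg (Real.sqrt_nonneg _)
  have h3 : ENNReal.ofReal |a⁻¹| ^ (1 / (2 : ℝ≥0∞)).toReal = ENNReal.ofReal ((√|a|)⁻¹) := by
    rw [ENNReal.ofReal_rpow_of_nonneg (abs_nonneg _) (by simp)]
    congr 1
    rw [abs_inv, ENNReal.toReal_div, ENNReal.toReal_one, ENNReal.toReal_ofNat,
      ← Real.sqrt_eq_rpow, Real.sqrt_inv]
  have h4 : 0 < √|a| := Real.sqrt_pos.2 (abs_pos.2 ha)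
  rw [h2, h3, smul_eq_mul, ← mul_assoc, ← ENNReal.ofReal_mul h4.le, mul_inv_cancel₀ h4.ne']
  simp

lemma memLp_affineComp {a : ℝ} (ha : a ≠ 0) (b : ℝ) {u : ℝ → ℂ} (hu : Measurable u)
    (hn : ∀ x, ‖u x‖ = √|a|) {f : ℝ → ℂ} (hf : MemLp f 2 volume) :
    MemLp (fun x => u x * f (a * x + b)) 2 volume :=
  ⟨hu.aestronglyMeasurable.mul
      (hf.1.comp_quasiMeasurePreserving (quasiMeasurePreserving_affine ha b)), by
    rw [eLpNorm_affineComp ha b hn hf.1]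
    exact hf.2⟩

/-- The isometry `(W ψ)(x) = u(x) ψ(a x + b)` of `L²(ℝ; ℂ)`, where `a ≠ 0` and
`|u(x)|² = |a|` for all `x`. -/
def affineComp (a b : ℝ) (ha : a ≠ 0) (u : ℝ → ℂ) (hu : Measurable u)
    (hn : ∀ x, ‖u x‖ = √|a|) : Mode →ₗᵢ[ℂ] Mode where
  toFun ψ := (memLp_affineComp ha b hu hn (Lp.memLp ψ)).toLp _
  map_add' ψ χ := by
    rw [← MemLp.toLp_add]
    refine MemLp.toLp_congr _ _ ?_
    filter_upwards [(quasiMeasurePreserving_affine ha b).ae (Lp.coeFn_add ψ χ)] with x hx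
    rw [hx]
    simp [mul_add]
  map_smul' c ψ := by
    rw [RingHom.id_apply, ← MemLp.toLp_const_smul]
    refine MemLp.toLp_congr _ _ ?_
    filter_upwards [(quasiMeasurePreserving_affine ha b).ae (Lp.coeFn_smul c ψ)] with x hx
    rw [hx]
    simp [mul_left_comm]
  norm_map' ψ := by
    change ‖(memLp_affineComp ha b hu hn (Lp.memLp ψ)).toLp _‖ = ‖ψ‖
    rw [Lp.norm_toLp, eLpNorm_affineComp ha b hn (Lp.memLp ψ).1, Lp.norm_def]

lemma affineComp_coeFn (a b : ℝ) (ha : a ≠ 0) (u : ℝ → ℂ) (hu : Measurable u)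
    (hn : ∀ x, ‖u x‖ = √|a|) (ψ : Mode) :
    affineComp a b ha u hu hn ψ =ᵐ[volume] fun x => u x * ψ (a * x + b) :=
  MemLp.coeFn_toLp (memLp_affineComp ha b hu hn (Lp.memLp ψ))

/-- The displacement operator
`D(α) = exp(α â† - α* â) = exp(i √2 (Im α q̂ - Re α p̂))`, that is,
`(D(α) ψ)(x) = exp(i (√2 Im α x - Re α Im α)) ψ(x - √2 Re α)`. -/
def displacement (α : ℂ) : Mode →L[ℂ] Mode :=
  (affineComp 1 (-(√2 * α.re)) one_ne_zero
    (fun x => Complex.exp (((√2 * α.im * x - α.re * α.im : ℝ) : ℂ) * Complex.I))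
    (by fun_prop)
    (fun x => by rw [Complex.norm_exp_ofReal_mul_I]; simp)).toContinuousLinearMap

/-- The squeezing operator with real parameter,
`S(r) = exp(r (â² - â†²) / 2) = exp(i r (q̂ p̂ + p̂ q̂) / 2)`, that is,
`(S(r) ψ)(x) = e^{r/2} ψ(e^r x)`. -/
def squeeze (r : ℝ) : Mode →L[ℂ] Mode :=
  (affineComp (Real.exp r) 0 (Real.exp_pos r).ne'
    (fun _ => ((Real.exp (r / 2) : ℝ) : ℂ)) measurable_const
    (fun _ => by
      rw [Complex.norm_real, Real.norm_of_nonneg (Real.exp_pos _).le,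
        abs_of_pos (Real.exp_pos _), Real.exp_half])).toContinuousLinearMap

/-- The parity operator `(Π ψ)(x) = ψ(-x)`. -/
def parity : Mode →L[ℂ] Mode :=
  (affineComp (-1) 0 (by norm_num) (fun _ => 1) measurable_const
    (fun _ => by simp)).toContinuousLinearMap

lemma memLp_vacuum :
    MemLp (fun x : ℝ => ((Real.pi ^ (-(1 / 4) : ℝ) * Real.exp (-x ^ 2 / 2) : ℝ) : ℂ)) 2
      volume := by
  rw [memLp_two_iff_integrable_sq_norm (by fun_prop)]
  have h : Integrable (fun x : ℝ => (Real.pi ^ (-(1 / 4) : ℝ)) ^ 2 * Real.exp (-1 * x ^ 2))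
      volume := (integrable_exp_neg_mul_sq one_pos).const_mul _
  refine h.congr (Filter.Eventually.of_forall fun x => ?_)
  simp only [Complex.norm_real, Real.norm_eq_abs, sq_abs]
  rw [mul_pow, ← Real.exp_nat_mul]
  congr 2
  push_cast
  ring

/-- The vacuum vector `|0⟩`, with wave function `π^{-1/4} e^{-x²/2}`. -/
def vacuum : Mode := memLp_vacuum.toLp _

/-! ### States and Gaussian states -/

/-- `T` is a trace-class operator with trace `t`: the series of diagonal entries converges to `t`
along every orthonormal basis. -/
def HasTrace (T : Mode →L[ℂ] Mode) (t : ℂ) : Prop :=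
  ∀ {ι : Type} (e : HilbertBasis ι ℂ Mode), HasSum (fun i => ⟪e i, T (e i)⟫_ℂ) t

/-- Density operators: positive semidefinite operators of unit trace. -/
def IsDensityOperator (ρ : Mode →L[ℂ] Mode) : Prop :=
  ρ.IsPositive ∧ HasTrace ρ 1

/-- The displaced state `ρ(α) = D(α) ρ D(α)†`. -/
def displaced (ρ : Mode →L[ℂ] Mode) (α : ℂ) : Mode →L[ℂ] Mode :=
  displacement α ∘L ρ ∘L ContinuousLinearMap.adjoint (displacement α)

/-- `W` is the Wigner function of `ρ`:
`W(q, p) = π⁻¹ Tr[ρ D(α) Π D(α)†]` with `α = (q + i p) / √2`, which is the same as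
`π⁻¹ ∫ dy e^{2 i p y} ⟨q - y| ρ |q + y⟩`. -/
def IsWignerFunction (ρ : Mode →L[ℂ] Mode) (W : (Fin 2 → ℝ) → ℝ) : Prop :=
  ∀ x : Fin 2 → ℝ,
    HasTrace (ρ ∘L displaced parity (⟨x 0 / √2, x 1 / √2⟩ : ℂ)) ((Real.pi * W x : ℝ) : ℂ)

/-- `ρ` is the Gaussian state with first moments `m` and covariance matrix `Γ / 2`: a density
operator whose Wigner function is
`exp[-(x - m)ᵀ Γ⁻¹ (x - m)] / (π √(det Γ))`. -/
def IsGaussianState (ρ : Mode →L[ℂ] Mode) (m : Fin 2 → ℝ) (Γ : Matrix (Fin 2) (Fin 2) ℝ) :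
    Prop :=
  IsDensityOperator ρ ∧
    IsWignerFunction ρ fun x =>
      Real.exp (-((x - m) ⬝ᵥ (Γ⁻¹.mulVec (x - m)))) / (Real.pi * √Γ.det)

/-- Twice the covariance matrix of a single-mode Gaussian state with squeezing strength `r`,
squeezing angle `φ` and mean thermal occupation number `n` (the state is pure for `n = 0`). -/
def squeezedCov (r φ n : ℝ) : Matrix (Fin 2) (Fin 2) ℝ :=
  (2 * n + 1) •
    !![Real.cosh (2 * r) - Real.cos φ * Real.sinh (2 * r), Real.sin φ * Real.sinh (2 * r);
       Real.sin φ * Real.sinh (2 * r), Real.cosh (2 * r) + Real.cos φ * Real.sinh (2 * r)]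

/-- The squeezed vacuum `|ξ⟩⟨ξ|` with `|ξ⟩ = S(r)|0⟩`, squeezed along `q̂`. -/
def squeezedVacuum (r : ℝ) : Mode →L[ℂ] Mode :=
  InnerProductSpace.rankOne ℂ (squeeze r vacuum) (squeeze r vacuum)

/-! ### Measurements -/

/-- Positive operator-valued measures with outcomes in a measurable space `M`. Only the values on
measurable sets matter. -/
structure POVM (M : Type*) [MeasurableSpace M] where
  /-- The effect of an event. -/
  effect : Set M → (Mode →L[ℂ] Mode)
  isPositive : ∀ A, MeasurableSet A → (effect A).IsPositive
  effect_univ : effect Set.univ = ContinuousLinearMap.id ℂ Mode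
  hasSum_iUnion : ∀ A : ℕ → Set M, (∀ n, MeasurableSet (A n)) →
    Pairwise (Function.onFun Disjoint A) →
    ∀ ψ : Mode, HasSum (fun n => ⟪ψ, effect (A n) ψ⟫_ℂ) ⟪ψ, effect (⋃ n, A n) ψ⟫_ℂ

lemma memLp_indicator (A : Set ℝ) (hA : MeasurableSet A) (ψ : Mode) :
    MemLp (A.indicator fun x => ψ x) 2 volume :=
  (Lp.memLp ψ).indicator hA

/-- Multiplication by the indicator function of a measurable set `A ⊆ ℝ`, as a linear map. -/
def positionProjₗ (A : Set ℝ) (hA : MeasurableSet A) : Mode →ₗ[ℂ] Mode where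
  toFun ψ := (memLp_indicator A hA ψ).toLp _
  map_add' ψ χ := by
    rw [← MemLp.toLp_add]
    refine MemLp.toLp_congr _ _ ?_
    filter_upwards [Lp.coeFn_add ψ χ] with x hx
    by_cases h : x ∈ A
    · simp only [Pi.add_apply, Set.indicator_of_mem h]
      exact hx
    · simp only [Pi.add_apply, Set.indicator_of_notMem h, add_zero]
  map_smul' c ψ := by
    rw [RingHom.id_apply, ← MemLp.toLp_const_smul]
    refine MemLp.toLp_congr _ _ ?_
    filter_upwards [Lp.coeFn_smul c ψ] with x hx
    by_cases h : x ∈ A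
    · simp only [Pi.smul_apply, Set.indicator_of_mem h]
      exact hx
    · simp only [Pi.smul_apply, Set.indicator_of_notMem h, smul_zero]

lemma positionProjₗ_coeFn (A : Set ℝ) (hA : MeasurableSet A) (ψ : Mode) :
    ∀ᵐ x : ℝ, (positionProjₗ A hA ψ : Mode) x = A.indicator (fun y => ψ y) x := by
  have h := MemLp.coeFn_toLp (memLp_indicator A hA ψ)
  exact h

/-- Multiplication by the indicator function of a measurable set `A ⊆ ℝ`, i.e. the spectral
projection of `q̂` for `A`. -/
def positionProj (A : Set ℝ) (hA : MeasurableSet A) : Mode →L[ℂ] Mode :=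
  (positionProjₗ A hA).mkContinuous 1 (fun ψ => by
    rw [one_mul]
    change ‖(memLp_indicator A hA ψ).toLp _‖ ≤ ‖ψ‖
    rw [Lp.norm_toLp, Lp.norm_def]
    exact ENNReal.toReal_mono (Lp.memLp ψ).2.ne (eLpNorm_indicator_le _))

lemma positionProj_coeFn (A : Set ℝ) (hA : MeasurableSet A) (ψ : Mode) :
    ∀ᵐ x : ℝ, (positionProj A hA ψ : Mode) x = A.indicator (fun y => ψ y) x :=
  positionProjₗ_coeFn A hA ψ

lemma inner_positionProj (A : Set ℝ) (hA : MeasurableSet A) (ψ χ : Mode) :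
    ⟪ψ, positionProj A hA χ⟫_ℂ = ∫ x in A, ⟪ψ x, χ x⟫_ℂ := by
  rw [L2.inner_def, ← integral_indicator hA]
  refine integral_congr_ae ?_
  filter_upwards [positionProj_coeFn A hA χ] with x hx
  rw [hx]
  by_cases h : x ∈ A <;> simp [h]

open Classical in
/-- Homodyne detection of the quadrature `q̂`: the POVM `{|q⟩⟨q|}`, whose effect of a Borel set
`A` is `∫_A |q⟩⟨q| dq`, multiplication by the indicator function of `A`. -/
def homodyne : POVM ℝ where
  effect A := if hA : MeasurableSet A then positionProj A hA else 0
  isPositive A hA := by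
    rw [dif_pos hA]
    refine ContinuousLinearMap.isPositive_def.2 ⟨?_, fun ψ => ?_⟩
    · intro ψ χ
      change ⟪positionProj A hA ψ, χ⟫_ℂ = ⟪ψ, positionProj A hA χ⟫_ℂ
      rw [← inner_conj_symm, inner_positionProj, inner_positionProj, ← integral_conj]
      simp only [inner_conj_symm]
    · rw [ContinuousLinearMap.reApplyInnerSelf_apply, inner_re_symm, inner_positionProj]
      have h : (fun x => ⟪ψ x, ψ x⟫_ℂ) = fun x => ((‖ψ x‖ ^ 2 : ℝ) : ℂ) := by
        funext x
        rw [inner_self_eq_norm_sq_to_K]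
        push_cast
        rfl
      rw [h, integral_complex_ofReal]
      simpa using integral_nonneg fun x => by positivity
  effect_univ := by
    rw [dif_pos MeasurableSet.univ]
    ext1 ψ
    refine Lp.ext ?_
    filter_upwards [positionProj_coeFn Set.univ MeasurableSet.univ ψ] with x hx
    rw [hx]
    simp
  hasSum_iUnion A hA hd ψ := by
    simp only [dif_pos (hA _), dif_pos (MeasurableSet.iUnion hA), inner_positionProj]
    exact hasSum_integral_iUnion hA hd (L2.integrable_inner ψ ψ).integrableOn

/-! ### Bayesian estimation of one displacement coordinate -/

/-- The kernel `κ` is the likelihood `p(m | α)` of the outcomes of the measurement `E` on the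
displaced probe, as given by the Born rule: `P(A | α) = Tr[E(A) D(α) ρ D(α)†]`. -/
def IsLikelihood {M : Type*} [MeasurableSpace M] (E : POVM M) (ρ : Mode →L[ℂ] Mode)
    (κ : Kernel ℂ M) : Prop :=
  ∀ (α : ℂ) (A : Set M), MeasurableSet A →
    HasTrace (E.effect A ∘L displaced ρ α) (((κ α).real A : ℝ) : ℂ)

/-- The prior of the displacement `α`: the real part `Re α` is normally distributed with mean `μ₀`
and variance `σ₀²`, and the imaginary part is independent of it with law `τ`. For
`τ = N(ν₀, σ₀²)` this is the isotropic Gaussian with density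
`exp(-|α - μ₀ - i ν₀|² / (2 σ₀²)) / (2 π σ₀²)`; for a point mass `τ` it is a Gaussian prior for a
single real parameter. -/
def prior (μ₀ σ₀ : ℝ) (τ : Measure ℝ) : Measure ℂ :=
  ((gaussianReal μ₀ (σ₀ ^ 2).toNNReal).prod τ).map Complex.measurableEquivRealProd.symm

instance (μ₀ σ₀ : ℝ) (τ : Measure ℝ) [IsProbabilityMeasure τ] :
    IsProbabilityMeasure (prior μ₀ σ₀ τ) :=
  Measure.isProbabilityMeasure_map (by fun_prop)

/-- The average over the outcomes `m` of the variance of the coordinate `Re α` under the posterior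
distribution `p(α | m)`, for the likelihood `κ` and the prior `π`:
`∫ p(dm) Var[Re α | m]`, where `p(dm)` is the unconditional law of the outcome. -/
def avgPosteriorVariance {M : Type*} [MeasurableSpace M] (κ : Kernel ℂ M) [IsMarkovKernel κ]
    (π : Measure ℂ) [IsProbabilityMeasure π] : ℝ≥0∞ :=
  ∫⁻ m, evariance Complex.re (posterior κ π m) ∂(π.bind κ)

end BosonicMode

end

noncomputable section

namespace BosonicMode

/-! ### Hilbert bases and traces of mixtures -/

/-! The lower bound is a Bayesian Cramér–Rao (van Trees) inequality. For unit vectors `χ a` with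
real overlap `exp (-(F/8) (a-b)²)`, where `F` is the quantum Fisher information, multiply by the
square root of the Gaussian prior density. The geometric mean of two values of that density is again
Gaussian in `a-b`, so the weighted vectors `u a` satisfy `∫ Re⟪u (a+k), u (a+l)⟫ = exp (-(J/8)
(k-l)²)` with `J = 1/σ₀² + F`. Cauchy–Schwarz between `(y-a) u a` and a symmetric difference of `u`,
summed over the effects, bounds the mean square error below by `J⁻¹` as the step tends to `0`
(`integral_shift_identity`, `bayes_bound_of_finite`). No derivative of `u` is needed.

A mixed Gaussian probe reduces to this case because it is a mixture of pure Gaussian states sharing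
one complex width `c` (`IsGaussianState.exists_isMixture`). The mean square error of a fixed
estimator is affine in the state, so a bound valid for each component survives averaging. Each
component has `F = 4 |c|² / Re c`, which equals `4 D / (2n+1)` with `D = cosh 2r + cos φ sinh 2r`,
and this is at most `4 exp (2r)` under the sign hypothesis. The decomposition is found by matching
Wigner functions; it applies to the given operator because the Wigner function determines the
integral kernel of a mixture through Fourier injectivity on antidiagonals
(`IsMixture.of_wigner_eq`).

General outcome spaces reduce to finitely many outcomes: the average posterior variance is the mean
square error of the posterior mean, which simple functions approximate in L²
(`le_avgPosteriorVariance`).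

For attainment, homodyne outcomes on the displaced squeezed vacuum are normal with mean `√2 Re α`.
The linear Bayes estimator has error exactly `J⁻¹`, and the lower bound supplies the reverse
inequality. -/

instance : TopologicalSpace.SeparableSpace Mode :=
  have : Fact ((2 : ℝ≥0∞) ≠ ∞) := ⟨by norm_num⟩
  have : SecondCountableTopology Mode := Lp.SecondCountableTopology
  inferInstance

/-- Distinct basis vectors are at distance `√2 > 1`, so balls of radius `1/2` around them are
disjoint. Countability of the index is what permits exchanging basis sums with integrals. -/
lemma countable_of_hilbertBasis {ι : Type*} (e : HilbertBasis ι ℂ Mode) : Countable ι := by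
  have hd : Pairwise (Function.onFun Disjoint fun i => Metric.ball (e i) (1 / 2)) := by
    intro i j hij
    refine Metric.ball_disjoint_ball ?_
    have h1 : ‖e i - e j‖ ^ 2 = 2 := by
      rw [@norm_sub_sq ℂ, e.orthonormal.1, e.orthonormal.1, e.orthonormal.2 hij]
      norm_num
    rw [dist_eq_norm]
    nlinarith [norm_nonneg (e i - e j)]
  have := Set.PairwiseDisjoint.countable_of_isOpen (s := fun i => Metric.ball (e i) (1 / 2))
    (a := Set.univ) (fun i _ j _ hij => hd hij) (fun i _ => Metric.isOpen_ball)
    (fun i _ => ⟨e i, Metric.mem_ball_self (by norm_num)⟩)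
  exact Set.countable_univ_iff.1 this

section Families

variable {X : Type*} [MeasurableSpace X] {ν : Measure X}

lemma integrable_inner_of_memLp_two {χ φ : X → Mode} (hχ : MemLp χ 2 ν) (hφ : MemLp φ 2 ν) :
    Integrable (fun x => ⟪χ x, φ x⟫_ℂ) ν := by
  refine (hχ.integrable_norm_pow (by norm_num) |>.add
    (hφ.integrable_norm_pow (by norm_num))).mono' (hχ.1.inner hφ.1)
    (Filter.Eventually.of_forall fun x => ?_)
  refine (norm_inner_le_norm _ _).trans ?_
  simp only [Pi.add_apply]
  nlinarith [sq_nonneg (‖χ x‖ - ‖φ x‖), sq_nonneg ‖χ x‖, sq_nonneg ‖φ x‖]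

lemma integrable_normSq_inner {φ : X → Mode} (hφ : MemLp φ 2 ν) (f : Mode) :
    Integrable (fun x => ‖⟪f, φ x⟫_ℂ‖ ^ 2) ν := by
  have h := (hφ.integrable_norm_pow (by norm_num)).const_mul (‖f‖ ^ 2)
  refine h.mono' ((aestronglyMeasurable_const.inner hφ.1).norm.pow 2)
    (Filter.Eventually.of_forall fun x => ?_)
  rw [Real.norm_of_nonneg (by positivity), ← mul_pow]
  exact pow_le_pow_left₀ (norm_nonneg _) (norm_inner_le_norm _ _) 2

lemma summable_integral_normSq_inner {ι : Type*} (e : HilbertBasis ι ℂ Mode) {φ : X → Mode}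
    (hφ : MemLp φ 2 ν) : Summable fun i => ∫ x, ‖⟪e i, φ x⟫_ℂ‖ ^ 2 ∂ν := by
  refine summable_of_sum_le (c := ∫ x, ‖φ x‖ ^ 2 ∂ν)
    (fun i => integral_nonneg fun x => by positivity) fun s => ?_
  rw [← integral_finsetSum _ fun i _ => integrable_normSq_inner hφ _]
  refine integral_mono (integrable_finsetSum _ fun i _ => integrable_normSq_inner hφ _)
    (hφ.integrable_norm_pow (by norm_num)) fun x => ?_
  exact e.orthonormal.sum_inner_products_le (φ x)

/-- Parseval's identity under the integral sign. Each term is dominated by a sum of two squared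
coefficients, whose integrals are summable by Bessel's inequality. -/
lemma hasSum_integral_inner_mul_inner {ι : Type*} (e : HilbertBasis ι ℂ Mode) {χ φ : X → Mode}
    (hχ : MemLp χ 2 ν) (hφ : MemLp φ 2 ν) :
    HasSum (fun i => ∫ x, ⟪χ x, e i⟫_ℂ * ⟪e i, φ x⟫_ℂ ∂ν) (∫ x, ⟪χ x, φ x⟫_ℂ ∂ν) := by
  have : Countable ι := countable_of_hilbertBasis e
  have hb : ∀ i x, ‖⟪χ x, e i⟫_ℂ * ⟪e i, φ x⟫_ℂ‖
      ≤ ‖⟪e i, χ x⟫_ℂ‖ ^ 2 + ‖⟪e i, φ x⟫_ℂ‖ ^ 2 := fun i x => by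
    rw [norm_mul, norm_inner_symm]
    nlinarith [sq_nonneg (‖⟪e i, χ x⟫_ℂ‖ - ‖⟪e i, φ x⟫_ℂ‖), sq_nonneg ‖⟪e i, χ x⟫_ℂ‖,
      sq_nonneg ‖⟪e i, φ x⟫_ℂ‖]
  have hi : ∀ i, Integrable (fun x => ⟪χ x, e i⟫_ℂ * ⟪e i, φ x⟫_ℂ) ν := fun i =>
    ((integrable_normSq_inner hχ _).add (integrable_normSq_inner hφ _)).mono'
      ((hχ.1.inner aestronglyMeasurable_const).mul (aestronglyMeasurable_const.inner hφ.1))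
      (Filter.Eventually.of_forall (hb i))
  have h := hasSum_integral_of_summable_integral_norm hi ?_
  · have h2 : ∀ x, ⟪χ x, φ x⟫_ℂ = ∑' i, ⟪χ x, e i⟫_ℂ * ⟪e i, φ x⟫_ℂ := fun x =>
      (e.hasSum_inner_mul_inner _ _).tsum_eq.symm
    simpa only [h2] using h
  · refine Summable.of_nonneg_of_le (fun i => integral_nonneg fun x => norm_nonneg _)
      (fun i => ?_) ((summable_integral_normSq_inner e hχ).add (summable_integral_normSq_inner e hφ))
    rw [← integral_add (integrable_normSq_inner hχ _) (integrable_normSq_inner hφ _)]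
    exact integral_mono (hi i).norm
      ((integrable_normSq_inner hχ _).add (integrable_normSq_inner hφ _)) (hb i)

/-- `ρ = ∫ |ψ x⟩⟨ψ x| dν(x)`. -/
structure IsMixture (ρ : Mode →L[ℂ] Mode) (ν : Measure X) (ψ : X → Mode) : Prop where
  memLp : MemLp ψ 2 ν
  inner_eq : ∀ f g, ⟪f, ρ g⟫_ℂ = ∫ x, ⟪f, ψ x⟫_ℂ * ⟪ψ x, g⟫_ℂ ∂ν

lemma memLp_clm_comp {φ : X → Mode} (hφ : MemLp φ 2 ν) (B : Mode →L[ℂ] Mode) :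
    MemLp (fun x => B (φ x)) 2 ν := B.comp_memLp' hφ

lemma IsMixture.hasTrace_comp {ρ : Mode →L[ℂ] Mode} {ψ : X → Mode} (h : IsMixture ρ ν ψ)
    (B : Mode →L[ℂ] Mode) : HasTrace (B ∘L ρ) (∫ x, ⟪ψ x, B (ψ x)⟫_ℂ ∂ν) := by
  intro ι e
  convert hasSum_integral_inner_mul_inner e h.memLp (memLp_clm_comp h.memLp B) using 2 with i
  rw [ContinuousLinearMap.comp_apply, ← ContinuousLinearMap.adjoint_inner_left, h.inner_eq]
  simp only [ContinuousLinearMap.adjoint_inner_left, mul_comm]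

/-- Born's rule has the state on the right of the product and the Wigner function has it on the
left, so both orders are needed. -/
lemma IsMixture.hasTrace_comp' {ρ : Mode →L[ℂ] Mode} {ψ : X → Mode} (h : IsMixture ρ ν ψ)
    (B : Mode →L[ℂ] Mode) : HasTrace (ρ ∘L B) (∫ x, ⟪ψ x, B (ψ x)⟫_ℂ ∂ν) := by
  intro ι e
  convert hasSum_integral_inner_mul_inner e
    (memLp_clm_comp h.memLp (ContinuousLinearMap.adjoint B)) h.memLp using 2 with i
  · rw [ContinuousLinearMap.comp_apply, h.inner_eq]
    simp only [ContinuousLinearMap.adjoint_inner_left, mul_comm]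
  · simp only [ContinuousLinearMap.adjoint_inner_left]

lemma IsMixture.displaced {ρ : Mode →L[ℂ] Mode} {ψ : X → Mode} (h : IsMixture ρ ν ψ) (α : ℂ) :
    IsMixture (displaced ρ α) ν fun x => displacement α (ψ x) where
  memLp := memLp_clm_comp h.memLp _
  inner_eq f g := by
    simp only [BosonicMode.displaced, ContinuousLinearMap.comp_apply]
    rw [← ContinuousLinearMap.adjoint_inner_left, h.inner_eq]
    simp only [ContinuousLinearMap.adjoint_inner_left, ContinuousLinearMap.adjoint_inner_right]

end Families

lemma HasTrace.unique {T : Mode →L[ℂ] Mode} {s t : ℂ} (hs : HasTrace T s) (ht : HasTrace T t) :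
    s = t := by
  obtain ⟨w, e, -⟩ := exists_hilbertBasis ℂ Mode
  exact (hs e).unique (ht e)

lemma isMixture_rankOne (ψ : Mode) :
    IsMixture (InnerProductSpace.rankOne ℂ ψ ψ) (Measure.dirac ()) fun _ => ψ where
  memLp := memLp_const _
  inner_eq f g := by simp [inner_smul_right, mul_comm]

lemma _root_.ContinuousLinearMap.IsPositive.exists_sqrt {H : Type*} [NormedAddCommGroup H]
    [InnerProductSpace ℂ H] [CompleteSpace H] {T : H →L[ℂ] H} (hT : T.IsPositive) :
    ∃ s : H →L[ℂ] H, (∀ x y, ⟪s x, y⟫_ℂ = ⟪x, s y⟫_ℂ) ∧ ∀ x, s (s x) = T x := by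
  have h0 : 0 ≤ T := (ContinuousLinearMap.nonneg_iff_isPositive T).2 hT
  refine ⟨CFC.sqrt T,
    ((ContinuousLinearMap.nonneg_iff_isPositive _).1 (CFC.sqrt_nonneg T)).isSymmetric,
    fun x => ?_⟩
  conv_rhs => rw [← CFC.sqrt_mul_sqrt_self T h0]
  rfl

/-- A density operator is a countable mixture of pure states. -/
lemma IsDensityOperator.exists_isMixture {ρ : Mode →L[ℂ] Mode} (h : IsDensityOperator ρ) :
    ∃ (ι : Type) (_ : Countable ι) (_ : MeasurableSpace ι) (_ : DiscreteMeasurableSpace ι)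
      (ψ : ι → Mode), IsMixture ρ Measure.count ψ := by
  obtain ⟨w, e, -⟩ := exists_hilbertBasis ℂ Mode
  have hc : Countable w := countable_of_hilbertBasis e
  let mw : MeasurableSpace w := ⊤
  have hdw : DiscreteMeasurableSpace w := ⟨fun _ => trivial⟩
  -- With `s = √ρ`, the decomposition is `ρ = ∑ |s eᵢ⟩⟨s eᵢ|`; square summability of `‖s eᵢ‖` is the
  -- finite trace of `ρ`.
  obtain ⟨s, hsa, hss⟩ := h.1.exists_sqrt
  have hρ : ∀ f g, ⟪f, ρ g⟫_ℂ = ⟪s f, s g⟫_ℂ := fun f g => by rw [hsa, hss]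
  have hm : MemLp (fun i => s (e i)) 2 (Measure.count : Measure w) := by
    rw [memLp_two_iff_integrable_sq_norm StronglyMeasurable.of_discrete.aestronglyMeasurable,
      integrable_count_iff]
    refine ((h.2 e).summable.norm).congr fun i => ?_
    rw [hρ, inner_self_eq_norm_sq_to_K, norm_pow]
    simp
  refine ⟨w, hc, mw, hdw, fun i => s (e i), hm, fun f g => ?_⟩
  have hi : Integrable (fun i => ⟪s f, e i⟫_ℂ * ⟪e i, s g⟫_ℂ) (Measure.count : Measure w) :=
    integrable_count_iff.2 (e.summable_inner_mul_inner _ _).norm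
  have h1 : ∀ i, ⟪f, s (e i)⟫_ℂ * ⟪s (e i), g⟫_ℂ = ⟪s f, e i⟫_ℂ * ⟪e i, s g⟫_ℂ := fun i => by
    rw [hsa f, hsa _ g]
  simp only [h1]
  rw [hρ, ← (e.hasSum_inner_mul_inner (s f) (s g)).tsum_eq, integral_countable hi]
  simp

/-! ### Displacement and parity operators -/

lemma displacement_coeFn (α : ℂ) (ψ : Mode) :
    displacement α ψ =ᵐ[volume] fun x : ℝ =>
      Complex.exp (((√2 * α.im * x - α.re * α.im : ℝ) : ℂ) * Complex.I) * ψ (x - √2 * α.re) := by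
  have h := affineComp_coeFn 1 (-(√2 * α.re)) one_ne_zero
    (fun x => Complex.exp (((√2 * α.im * x - α.re * α.im : ℝ) : ℂ) * Complex.I))
    (by fun_prop) (fun x => by rw [Complex.norm_exp_ofReal_mul_I]; simp) ψ
  simp only [one_mul, ← sub_eq_add_neg] at h
  exact h

lemma parity_coeFn (ψ : Mode) : parity ψ =ᵐ[volume] fun x : ℝ => ψ (-x) := by
  have h := affineComp_coeFn (-1) 0 (by norm_num) (fun _ => 1) measurable_const
    (fun _ => by simp) ψ
  simp only [one_mul, neg_mul, add_zero] at h
  exact h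

lemma quasiMeasurePreserving_sub_const (b : ℝ) :
    Measure.QuasiMeasurePreserving (fun x : ℝ => x - b) volume volume := by
  simpa [sub_eq_add_neg] using quasiMeasurePreserving_affine one_ne_zero (-b)

lemma inner_displacement (α : ℂ) (ψ χ : Mode) :
    ⟪displacement α ψ, displacement α χ⟫_ℂ = ⟪ψ, χ⟫_ℂ :=
  LinearIsometry.inner_map_map _ ψ χ

lemma displacement_displacement_neg (α : ℂ) (ψ : Mode) :
    displacement α (displacement (-α) ψ) = ψ := by
  refine Lp.ext ?_
  filter_upwards [displacement_coeFn α (displacement (-α) ψ),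
    (quasiMeasurePreserving_sub_const (√2 * α.re)).ae (displacement_coeFn (-α) ψ)] with x h1 h2
  rw [h1, h2, ← mul_assoc, ← Complex.exp_add]
  have h3 : (x - √2 * α.re - √2 * (-α).re) = x := by simp
  have h4 : (((√2 * α.im * x - α.re * α.im : ℝ) : ℂ) * Complex.I +
      ((√2 * (-α).im * (x - √2 * α.re) - (-α).re * (-α).im : ℝ) : ℂ) * Complex.I) = 0 := by
    rw [← add_mul, ← Complex.ofReal_add]
    have h5 : √2 * α.im * x - α.re * α.im +
      (√2 * (-α).im * (x - √2 * α.re) - (-α).re * (-α).im) = 0 := by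
      have h6 : √2 * √2 = 2 := Real.mul_self_sqrt (by norm_num)
      simp only [Complex.neg_im, Complex.neg_re]
      linear_combination (α.im * α.re) * h6
    rw [h5]
    simp
  rw [h3, h4, Complex.exp_zero, one_mul]

lemma adjoint_displacement (α : ℂ) (ψ : Mode) :
    ContinuousLinearMap.adjoint (displacement α) ψ = displacement (-α) ψ := by
  refine ext_inner_right ℂ fun f => ?_
  rw [ContinuousLinearMap.adjoint_inner_left, ← inner_displacement α (displacement (-α) ψ),
    displacement_displacement_neg]

/-- Displaced parity is the point reflection of phase space about `(q, p)`. Its plane-wave factor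
makes the Wigner function a Fourier integral in `p` along the antidiagonal of sum `2 q`. -/
lemma displaced_parity_coeFn (q p : ℝ) (ψ : Mode) :
    displaced parity (⟨q / √2, p / √2⟩ : ℂ) ψ =ᵐ[volume] fun y : ℝ =>
      Complex.exp ((2 * p * (y - q) : ℝ) * Complex.I) * ψ (2 * q - y) := by
  have e0 : displaced parity (⟨q / √2, p / √2⟩ : ℂ) ψ = displacement (⟨q / √2, p / √2⟩ : ℂ)
      (parity (displacement (-(⟨q / √2, p / √2⟩ : ℂ)) ψ)) := by
    rw [← adjoint_displacement]
    rfl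
  have hs : √2 ≠ 0 := by positivity
  have hs2 : √2 * √2 = 2 := Real.mul_self_sqrt (by norm_num)
  have e1 : √2 * (q / √2) = q := by field_simp
  have e2 : √2 * (p / √2) = p := by field_simp
  have e3 : q / √2 * (p / √2) = q * p / 2 := by
    rw [div_mul_div_comm, hs2]
  have h1 := displacement_coeFn (⟨q / √2, p / √2⟩ : ℂ)
      (parity (displacement (-(⟨q / √2, p / √2⟩ : ℂ)) ψ))
  have h2 := parity_coeFn (displacement (-(⟨q / √2, p / √2⟩ : ℂ)) ψ)
  have h3 := displacement_coeFn (-(⟨q / √2, p / √2⟩ : ℂ)) ψ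
  simp only [Complex.neg_re, Complex.neg_im, mul_neg, neg_mul, neg_neg, e1, e2, e3,
    sub_neg_eq_add] at h1 h3
  rw [e0]
  have hq : Measure.QuasiMeasurePreserving (fun x : ℝ => -(x - q)) volume volume := by
    simpa [neg_add_eq_sub] using quasiMeasurePreserving_affine (a := -1) (by norm_num) q
  filter_upwards [h1, (quasiMeasurePreserving_sub_const q).ae h2, hq.ae h3] with y g1 g2 g3
  rw [g1, g2, g3, ← mul_assoc, ← Complex.exp_add]
  congr 2
  · push_cast; ring
  · ring

/-! ### Families of wave functions -/

/-- Injectivity of the Fourier transform on integrable functions. -/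
lemma ae_eq_zero_of_fourier_eq_zero {h : ℝ → ℂ} (hi : Integrable h)
    (h0 : ∀ p : ℝ, ∫ y, Complex.exp ((2 * p * y : ℝ) * Complex.I) * h y = 0) :
    h =ᵐ[volume] 0 := by
  have hF : ∀ w : ℝ, FourierTransform.fourier h w = 0 := fun w => by
    rw [Real.fourier_eq', ← h0 (-Real.pi * w)]
    refine integral_congr_ae (Filter.Eventually.of_forall fun y => ?_)
    simp only [smul_eq_mul]
    congr 2
    simp
    ring
  -- Every test function is the Fourier transform of a Schwartz function, so moving the transform
  -- onto `h` shows that `h` annihilates all test functions.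
  refine ae_eq_zero_of_integral_contDiff_smul_eq_zero hi.locallyIntegrable fun g hg hgc => ?_
  have hg' : ContDiff ℝ (⊤ : ℕ∞) fun x => (g x : ℂ) :=
    Complex.ofRealCLM.contDiff.comp hg
  have hgc' : HasCompactSupport fun x => (g x : ℂ) :=
    hgc.comp_left (g := fun x : ℝ => (x : ℂ)) (by simp)
  let φ : SchwartzMap ℝ ℂ := hgc'.toSchwartzMap hg'
  let χ : SchwartzMap ℝ ℂ := FourierTransformInv.fourierInv φ
  have hχ : FourierTransform.fourier (χ : ℝ → ℂ) = fun x => (g x : ℂ) := by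
    have h1 : FourierTransform.fourier χ = φ := FourierTransform.fourier_fourierInv_eq φ
    rw [← SchwartzMap.fourier_coe, h1]
    rfl
  have h2 : ∫ w, FourierTransform.fourier h w • χ w
      = ∫ x, h x • FourierTransform.fourier (χ : ℝ → ℂ) x := by
    simpa using! (VectorFourier.integral_fourierIntegral_smul_eq_flip (L := innerₗ ℝ)
      Real.continuous_fourierChar continuous_inner hi χ.integrable)
  simp only [hF, zero_smul, integral_zero, hχ] at h2
  rw [h2]
  refine integral_congr_ae (Filter.Eventually.of_forall fun x => ?_)
  simp [mul_comm]

variable {X : Type*} [MeasurableSpace X] {ν : Measure X}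

/-- `Ψ` is a jointly measurable version of the family `ψ` of wave functions. -/
structure IsVersion (Ψ : X → ℝ → ℂ) (ψ : X → Mode) : Prop where
  measurable : Measurable (Function.uncurry Ψ)
  ae_eq : ∀ x, ψ x =ᵐ[volume] Ψ x

lemma exists_isVersion {ι : Type*} [Countable ι] [MeasurableSpace ι] [DiscreteMeasurableSpace ι]
    (ψ : ι → Mode) : ∃ Ψ, IsVersion Ψ ψ := by
  refine ⟨fun i => ψ i, ?_, fun x => Filter.EventuallyEq.rfl⟩
  exact measurable_from_prod_countable_right fun i => (Lp.stronglyMeasurable (ψ i)).measurable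

lemma IsVersion.norm_sq {Ψ : X → ℝ → ℂ} {ψ : X → Mode} (h : IsVersion Ψ ψ) (x : X) :
    MemLp (Ψ x) 2 volume ∧ ∫ y, ‖Ψ x y‖ ^ 2 = ‖ψ x‖ ^ 2 := by
  refine ⟨(memLp_congr_ae (h.ae_eq x)).1 (Lp.memLp (ψ x)), ?_⟩
  have h1 : ((‖ψ x‖ ^ 2 : ℝ) : ℂ) = ⟪ψ x, ψ x⟫_ℂ := by
    rw [inner_self_eq_norm_sq_to_K]; push_cast; rfl
  have h2 : ((∫ y, ‖Ψ x y‖ ^ 2 : ℝ) : ℂ) = ⟪ψ x, ψ x⟫_ℂ := by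
    rw [L2.inner_def, ← integral_complex_ofReal]
    refine integral_congr_ae ?_
    filter_upwards [h.ae_eq x] with y hy
    rw [hy, inner_self_eq_norm_sq_to_K]; push_cast; rfl
  exact_mod_cast h2.trans h1.symm

lemma integral_norm_mul_norm_le {f g : ℝ → ℂ} (hf : MemLp f 2 volume) (hg : MemLp g 2 volume)
    {a b : ℝ} (ha : 0 ≤ a) (hb : 0 ≤ b) (hfa : ∫ y, ‖f y‖ ^ 2 = a ^ 2)
    (hgb : ∫ y, ‖g y‖ ^ 2 = b ^ 2) : ∫ y, ‖f y‖ * ‖g y‖ ≤ a * b := by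
  have h := integral_mul_le_Lp_mul_Lq_of_nonneg (p := 2) (q := 2) (μ := volume)
    (f := fun y => ‖f y‖) (g := fun y => ‖g y‖) (by constructor <;> norm_num)
    (Filter.Eventually.of_forall fun _ => norm_nonneg _)
    (Filter.Eventually.of_forall fun _ => norm_nonneg _)
    (by simpa using hf.norm) (by simpa using hg.norm)
  simp only [Real.rpow_two, hfa, hgb, ← Real.sqrt_eq_rpow, Real.sqrt_sq ha, Real.sqrt_sq hb] at h
  exact h

/-- The integral kernel of `∫ |ψ x⟩⟨ψ x| dν(x)`. -/
def mixtureKernel (ν : Measure X) (Ψ : X → ℝ → ℂ) (z : ℝ × ℝ) : ℂ :=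
  ∫ x, Ψ x z.1 * (starRingEnd ℂ) (Ψ x z.2) ∂ν

/-! ### Integral kernels of mixtures and their antidiagonals -/

section Kernel

variable {Ψ : X → ℝ → ℂ} {ψ : X → Mode}

lemma IsVersion.stronglyMeasurable_mixtureKernel [SFinite ν] (h : IsVersion Ψ ψ) :
    StronglyMeasurable (mixtureKernel ν Ψ) := by
  have hm : Measurable fun w : (ℝ × ℝ) × X =>
      Ψ w.2 w.1.1 * (starRingEnd ℂ) (Ψ w.2 w.1.2) := by
    have h1 : Measurable fun w : (ℝ × ℝ) × X => Ψ w.2 w.1.1 :=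
      h.measurable.comp (measurable_snd.prodMk (measurable_fst.comp measurable_fst))
    have h2 : Measurable fun w : (ℝ × ℝ) × X => Ψ w.2 w.1.2 :=
      h.measurable.comp (measurable_snd.prodMk (measurable_snd.comp measurable_fst))
    exact h1.mul (Complex.continuous_conj.measurable.comp h2)
  exact hm.stronglyMeasurable.integral_prod_right

/-- Fubini: Cauchy–Schwarz in each position variable bounds the absolute integral for fixed `x` by
`‖f‖ ‖g‖ ‖ψ x‖²`, which is integrable. -/
lemma IsVersion.integral_inner_mul_inner [SFinite ν] (h : IsVersion Ψ ψ) (hψ : MemLp ψ 2 ν) (f g : Mode) :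
    ∫ x, ⟪f, ψ x⟫_ℂ * ⟪ψ x, g⟫_ℂ ∂ν
      = ∫ z : ℝ × ℝ, (starRingEnd ℂ) (f z.1) * g z.2 * mixtureKernel ν Ψ z := by
  let F : X → ℝ × ℝ → ℂ := fun x z =>
    ((starRingEnd ℂ) (f z.1) * Ψ x z.1) * ((starRingEnd ℂ) (Ψ x z.2) * g z.2)
  have hf := (Lp.stronglyMeasurable f).measurable
  have hg := (Lp.stronglyMeasurable g).measurable
  have hF : Measurable (Function.uncurry F) := by
    have h1 : Measurable fun w : X × ℝ × ℝ => Ψ w.1 w.2.1 :=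
      h.measurable.comp (measurable_fst.prodMk (measurable_fst.comp measurable_snd))
    have h2 : Measurable fun w : X × ℝ × ℝ => Ψ w.1 w.2.2 :=
      h.measurable.comp (measurable_fst.prodMk (measurable_snd.comp measurable_snd))
    have hc := Complex.continuous_conj.measurable
    exact ((hc.comp (hf.comp (measurable_fst.comp measurable_snd))).mul h1).mul
      ((hc.comp h2).mul (hg.comp (measurable_snd.comp measurable_snd)))
  have hfn : ∫ y, ‖f y‖ ^ 2 = ‖f‖ ^ 2 :=
    ((IsVersion.norm_sq (X := Unit) (Ψ := fun _ => f) (ψ := fun _ => f)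
      ⟨hf.comp measurable_snd, fun _ => Filter.EventuallyEq.rfl⟩) ()).2
  have hgn : ∫ y, ‖g y‖ ^ 2 = ‖g‖ ^ 2 :=
    ((IsVersion.norm_sq (X := Unit) (Ψ := fun _ => g) (ψ := fun _ => g)
      ⟨hg.comp measurable_snd, fun _ => Filter.EventuallyEq.rfl⟩) ()).2
  have hi1 : ∀ x, Integrable fun y => (starRingEnd ℂ) (f y) * Ψ x y := fun x =>
    (Lp.memLp f).star.integrable_mul (h.norm_sq x).1
  have hi2 : ∀ x, Integrable fun y => (starRingEnd ℂ) (Ψ x y) * g y := fun x =>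
    (h.norm_sq x).1.star.integrable_mul (Lp.memLp g)
  have hint : Integrable (Function.uncurry F) (ν.prod volume) := by
    refine (integrable_prod_iff hF.aestronglyMeasurable).2
      ⟨Filter.Eventually.of_forall fun x => (hi1 x).mul_prod (hi2 x), ?_⟩
    refine ((hψ.integrable_norm_pow (by norm_num)).const_mul (‖f‖ * ‖g‖)).mono'
      hF.norm.aestronglyMeasurable.integral_prod_right' (Filter.Eventually.of_forall fun x => ?_)
    rw [Real.norm_of_nonneg (integral_nonneg fun _ => norm_nonneg _)]
    have h1 : ∫ z, ‖Function.uncurry F (x, z)‖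
        = (∫ y, ‖f y‖ * ‖Ψ x y‖) * ∫ y, ‖Ψ x y‖ * ‖g y‖ := by
      rw [← integral_prod_mul]
      simp [F]
      rfl
    rw [h1]
    have h2 := integral_norm_mul_norm_le (Lp.memLp f) (h.norm_sq x).1 (norm_nonneg f)
      (norm_nonneg (ψ x)) hfn (h.norm_sq x).2
    have h3 := integral_norm_mul_norm_le (h.norm_sq x).1 (Lp.memLp g) (norm_nonneg (ψ x))
      (norm_nonneg g) (h.norm_sq x).2 hgn
    calc _ ≤ (‖f‖ * ‖ψ x‖) * (‖ψ x‖ * ‖g‖) :=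
          mul_le_mul h2 h3 (integral_nonneg fun _ => by positivity) (by positivity)
      _ = _ := by ring
  have h1 : ∀ x, ⟪f, ψ x⟫_ℂ * ⟪ψ x, g⟫_ℂ = ∫ z : ℝ × ℝ, F x z := fun x => by
    have e1 : ⟪f, ψ x⟫_ℂ = ∫ y, (starRingEnd ℂ) (f y) * Ψ x y := by
      rw [L2.inner_def]
      refine integral_congr_ae ?_
      filter_upwards [h.ae_eq x] with y hy
      rw [hy, RCLike.inner_apply', mul_comm]
    have e2 : ⟪ψ x, g⟫_ℂ = ∫ y, (starRingEnd ℂ) (Ψ x y) * g y := by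
      rw [L2.inner_def]
      refine integral_congr_ae ?_
      filter_upwards [h.ae_eq x] with y hy
      rw [hy, RCLike.inner_apply', mul_comm]
    rw [e1, e2, ← integral_prod_mul]
    rfl
  simp only [h1]
  rw [integral_integral_swap hint]
  refine integral_congr_ae (Filter.Eventually.of_forall fun z => ?_)
  simp only [mixtureKernel]
  rw [← integral_const_mul]
  refine integral_congr_ae (Filter.Eventually.of_forall fun x => ?_)
  simp only [F]
  ring

/-- An antidiagonal is a null set of the plane, yet integrability holds on every one of them:
reflection preserves Lebesgue measure, so Cauchy–Schwarz bounds the inner integral by `‖ψ x‖²`. -/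
lemma IsVersion.integrable_antidiagonal (h : IsVersion Ψ ψ) (hψ : MemLp ψ 2 ν) (s : ℝ) :
    Integrable (fun w : X × ℝ => Ψ w.1 (s - w.2) * (starRingEnd ℂ) (Ψ w.1 w.2))
      (ν.prod volume) := by
  have hm : Measurable fun w : X × ℝ => Ψ w.1 (s - w.2) * (starRingEnd ℂ) (Ψ w.1 w.2) := by
    have h1 : Measurable fun w : X × ℝ => Ψ w.1 (s - w.2) :=
      h.measurable.comp (measurable_fst.prodMk (measurable_const.sub measurable_snd))
    exact h1.mul (Complex.continuous_conj.measurable.comp h.measurable)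
  have hr : ∀ x, MemLp (fun y => Ψ x (s - y)) 2 volume := fun x =>
    (h.norm_sq x).1.comp_measurePreserving (Measure.measurePreserving_sub_left volume s)
  refine (integrable_prod_iff hm.aestronglyMeasurable).2
      ⟨Filter.Eventually.of_forall fun x => (hr x).integrable_mul (h.norm_sq x).1.star, ?_⟩
  refine (hψ.integrable_norm_pow (by norm_num)).mono'
    hm.norm.aestronglyMeasurable.integral_prod_right' (Filter.Eventually.of_forall fun x => ?_)
  rw [Real.norm_of_nonneg (integral_nonneg fun _ => norm_nonneg _)]
  have h3 := integral_norm_mul_norm_le (hr x) (h.norm_sq x).1 (norm_nonneg (ψ x))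
      (norm_nonneg (ψ x)) ?_ (h.norm_sq x).2
  · calc _ = ∫ y, ‖Ψ x (s - y)‖ * ‖Ψ x y‖ := by simp
      _ ≤ _ := h3
      _ = _ := by ring
  · rw [← (h.norm_sq x).2, integral_sub_left_eq_self (fun y => ‖Ψ x y‖ ^ 2)]

lemma inner_displaced_parity {φ : Mode} {f : ℝ → ℂ} (hf : φ =ᵐ[volume] f) (q p : ℝ) :
    ⟪φ, displaced parity (⟨q / √2, p / √2⟩ : ℂ) φ⟫_ℂ
      = ∫ y, Complex.exp ((2 * p * (y - q) : ℝ) * Complex.I) *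
          (f (2 * q - y) * (starRingEnd ℂ) (f y)) := by
  rw [L2.inner_def]
  refine integral_congr_ae ?_
  filter_upwards [displaced_parity_coeFn q p φ, hf,
    (Measure.measurePreserving_sub_left volume (2 * q)).quasiMeasurePreserving.ae hf] with y h1 h2 h3
  rw [h1, h2, h3, RCLike.inner_apply']
  ring

lemma IsVersion.integral_displaced_parity [SFinite ν] (h : IsVersion Ψ ψ) (hψ : MemLp ψ 2 ν) (q p : ℝ) :
    ∫ x, ⟪ψ x, displaced parity (⟨q / √2, p / √2⟩ : ℂ) (ψ x)⟫_ℂ ∂ν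
      = ∫ y, Complex.exp ((2 * p * (y - q) : ℝ) * Complex.I) *
          mixtureKernel ν Ψ (2 * q - y, y) := by
  simp only [fun x => inner_displaced_parity (h.ae_eq x) q p]
  rw [integral_integral_swap]
  · simp only [mixtureKernel, integral_const_mul]
  · refine (h.integrable_antidiagonal hψ (2 * q)).bdd_mul (c := 1) ?_
      (Filter.Eventually.of_forall fun w => ?_)
    · have hc : Continuous fun y : ℝ => Complex.exp ((2 * p * (y - q) : ℝ) * Complex.I) := by
        fun_prop
      exact (hc.measurable.comp measurable_snd).aestronglyMeasurable
    · rw [Complex.norm_exp_ofReal_mul_I]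

end Kernel

/-- A mixture is determined by its Wigner function. -/
lemma IsMixture.of_wigner_eq {Y : Type*} [MeasurableSpace Y] {ν' : Measure Y} [SFinite ν]
    [SFinite ν'] {ρ : Mode →L[ℂ] Mode} {ψ : X → Mode} {ψ' : Y → Mode} {Ψ : X → ℝ → ℂ}
    {Ψ' : Y → ℝ → ℂ} (hρ : IsMixture ρ ν ψ) (hψ' : MemLp ψ' 2 ν') (h : IsVersion Ψ ψ)
    (h' : IsVersion Ψ' ψ')
    (hw : ∀ q p : ℝ, ∫ x, ⟪ψ x, BosonicMode.displaced parity (⟨q / √2, p / √2⟩ : ℂ) (ψ x)⟫_ℂ ∂ν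
      = ∫ x, ⟪ψ' x, BosonicMode.displaced parity (⟨q / √2, p / √2⟩ : ℂ) (ψ' x)⟫_ℂ ∂ν') :
    IsMixture ρ ν' ψ' := by
  refine ⟨hψ', fun f g => ?_⟩
  rw [hρ.inner_eq, h.integral_inner_mul_inner hρ.memLp, h'.integral_inner_mul_inner hψ']
  have hm := h.stronglyMeasurable_mixtureKernel (ν := ν)
  have hm' := h'.stronglyMeasurable_mixtureKernel (ν := ν')
  have hs : ∀ s : ℝ, ∀ᵐ y, mixtureKernel ν Ψ (s - y, y) = mixtureKernel ν' Ψ' (s - y, y) := by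
    intro s
    have i1 := (h.integrable_antidiagonal hρ.memLp s).integral_prod_right
    have i2 := (h'.integrable_antidiagonal hψ' s).integral_prod_right
    have hz := ae_eq_zero_of_fourier_eq_zero (i1.sub i2) fun p => ?_
    · filter_upwards [hz] with y hy
      exact sub_eq_zero.1 hy
    -- The phase-space position `q = s/2` selects the antidiagonal of sum `s`; a phase independent
    -- of `y` then cancels.
    · have hp := hw (s / 2) p
      rw [h.integral_displaced_parity hρ.memLp, h'.integral_displaced_parity hψ'] at hp
      have hb : ∀ y : ℝ, Complex.exp ((2 * p * (y - s / 2) : ℝ) * Complex.I)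
          = Complex.exp (-(p * s : ℝ) * Complex.I) * Complex.exp ((2 * p * y : ℝ) * Complex.I) :=
        fun y => by
          rw [← Complex.exp_add]
          congr 1
          push_cast
          ring
      rw [mul_div_cancel₀ s two_ne_zero] at hp
      simp only [hb] at hp
      simp only [mul_assoc (Complex.exp (-(p * s : ℝ) * Complex.I)), integral_const_mul] at hp
      have hp' := mul_left_cancel₀ (Complex.exp_ne_zero _) hp
      have hexp : ∀ {k : ℝ → ℂ}, Integrable k →
          Integrable fun y => Complex.exp ((2 * p * y : ℝ) * Complex.I) * k y := fun hk =>
        hk.bdd_mul (c := 1) (Continuous.aestronglyMeasurable (by fun_prop))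
          (Filter.Eventually.of_forall fun w => by rw [Complex.norm_exp_ofReal_mul_I])
      simp only [Pi.sub_apply, mul_sub]
      rw [integral_sub (hexp i1) (hexp i2), sub_eq_zero]
      simpa only [mul_assoc, mixtureKernel] using hp'
  -- Agreement a.e. on each antidiagonal becomes agreement a.e. in the plane by Fubini and
  -- translation invariance in `s`.
  have hK : mixtureKernel ν Ψ =ᵐ[volume] mixtureKernel ν' Ψ' := by
    have hset : MeasurableSet {z : ℝ × ℝ | mixtureKernel ν Ψ (z.1, z.2)
        = mixtureKernel ν' Ψ' (z.1, z.2)} :=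
      measurableSet_eq_fun hm.measurable hm'.measurable
    have hsh : MeasurableSet {z : ℝ × ℝ | mixtureKernel ν Ψ (z.1 - z.2, z.2)
        = mixtureKernel ν' Ψ' (z.1 - z.2, z.2)} :=
      measurableSet_eq_fun
        (hm.measurable.comp ((measurable_fst.sub measurable_snd).prodMk measurable_snd))
        (hm'.measurable.comp ((measurable_fst.sub measurable_snd).prodMk measurable_snd))
    have h1 : ∀ᵐ y : ℝ, ∀ᵐ s : ℝ, mixtureKernel ν Ψ (s - y, y)
        = mixtureKernel ν' Ψ' (s - y, y) :=
      (Measure.ae_ae_comm hsh).1 (Filter.Eventually.of_forall hs)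
    have h2 : ∀ᵐ y : ℝ, ∀ᵐ s : ℝ, mixtureKernel ν Ψ (s, y) = mixtureKernel ν' Ψ' (s, y) := by
      filter_upwards [h1] with y hy
      have := (measurePreserving_add_right volume y).quasiMeasurePreserving.ae hy
      simpa using this
    have h3 := (Measure.ae_ae_comm hset).2 h2
    exact (Measure.ae_prod_iff_ae_ae hset).2 h3
  refine integral_congr_ae ?_
  filter_upwards [hK] with z hz
  rw [hz]

/-! ### Pure Gaussian states -/

lemma integral_normalized_cexp_quadratic {r : ℝ} (hr : 0 < r) (l k : ℂ) :
    ∫ x : ℝ, (√(r / Real.pi) : ℂ) * Complex.exp (-r * x ^ 2 + l * x + k)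
      = Complex.exp (k + l ^ 2 / (4 * r)) := by
  have hr' : (r : ℂ) ≠ 0 := by exact_mod_cast hr.ne'
  rw [integral_const_mul, integral_cexp_quadratic (b := -(r : ℂ)) (by simpa using hr), neg_neg,
    ← mul_assoc]
  have h1 : ((Real.pi / r : ℂ)) ^ (1 / 2 : ℂ) = ((√(Real.pi / r) : ℝ) : ℂ) := by
    rw [Real.sqrt_eq_rpow, Complex.ofReal_cpow (by positivity)]
    push_cast
    rfl
  have h2 : (√(r / Real.pi) : ℂ) * ((√(Real.pi / r) : ℝ) : ℂ) = 1 := by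
    rw [← Complex.ofReal_mul, ← Real.sqrt_mul (by positivity)]
    have : r / Real.pi * (Real.pi / r) = 1 := by field_simp
    rw [this]
    simp
  rw [h1, h2, one_mul]
  congr 1
  field_simp
  ring

/-- The normalised Gaussian wave function with complex width `c`, position `q`, momentum `p`. -/
def gaussWave (c : ℂ) (q p : ℝ) (x : ℝ) : ℂ :=
  ((c.re / Real.pi) ^ (1 / 4 : ℝ) : ℝ) *
    Complex.exp (-c * (x - q) ^ 2 / 2 + p * x * Complex.I)

lemma measurable_gaussWave {Y : Type*} [MeasurableSpace Y] (c : ℂ) {q p x : Y → ℝ}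
    (hq : Measurable q) (hp : Measurable p) (hx : Measurable x) :
    Measurable fun y => gaussWave c (q y) (p y) (x y) := by
  unfold gaussWave
  fun_prop

lemma rpow_quarter_mul_self {a : ℝ} (ha : 0 ≤ a) : a ^ (1 / 4 : ℝ) * a ^ (1 / 4 : ℝ) = √a := by
  rw [← Real.rpow_add_of_nonneg ha (by norm_num) (by norm_num), Real.sqrt_eq_rpow]
  norm_num

lemma gaussWave_mul_conj {c : ℂ} (hc : 0 < c.re) (q p q' p' x y : ℝ) :
    gaussWave c q p x * (starRingEnd ℂ) (gaussWave c q' p' y) = (√(c.re / Real.pi) : ℂ) *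
      Complex.exp (-c * (x - q) ^ 2 / 2 + p * x * Complex.I +
        (-(starRingEnd ℂ) c * (y - q') ^ 2 / 2 - p' * y * Complex.I)) := by
  have h : (starRingEnd ℂ) (gaussWave c q' p' y) = ((c.re / Real.pi) ^ (1 / 4 : ℝ) : ℝ) *
      Complex.exp (-(starRingEnd ℂ) c * (y - q') ^ 2 / 2 - p' * y * Complex.I) := by
    simp only [gaussWave, map_mul, ← Complex.exp_conj, Complex.conj_ofReal]
    congr 2
    simp only [map_add, map_mul, map_div₀, map_neg, map_pow, map_sub, Complex.conj_ofReal,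
      Complex.conj_I, map_ofNat]
    ring
  rw [h, Complex.exp_add, ← rpow_quarter_mul_self (a := c.re / Real.pi) (by positivity), gaussWave]
  push_cast
  ring

lemma memLp_gaussWave {c : ℂ} (hc : 0 < c.re) (q p : ℝ) : MemLp (gaussWave c q p) 2 volume := by
  have hm : Measurable (gaussWave c q p) :=
    measurable_gaussWave c measurable_const measurable_const measurable_id
  rw [memLp_two_iff_integrable_sq_norm hm.aestronglyMeasurable]
  have h := (integrable_exp_neg_mul_sq hc).comp_sub_right q
  refine (h.const_mul (√(c.re / Real.pi))).congr (Filter.Eventually.of_forall fun x => ?_)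
  simp only [gaussWave, norm_mul, Complex.norm_exp, mul_pow, Complex.norm_real]
  rw [Real.norm_of_nonneg (by positivity), sq (_ ^ _), rpow_quarter_mul_self (by positivity),
    sq (Real.exp _), ← Real.exp_add]
  congr 2
  have h1 : (-c * ((x : ℂ) - q) ^ 2 / 2 + p * x * Complex.I).re = -c.re * (x - q) ^ 2 / 2 := by
    have : -c * ((x : ℂ) - q) ^ 2 / 2 = ((-(x - q) ^ 2 / 2 : ℝ) : ℂ) * c := by
      push_cast; ring
    rw [this, Complex.add_re, Complex.re_ofReal_mul]
    simp
    ring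
  rw [h1]
  ring

/-- The pure Gaussian state with wave function `gaussWave c q p`. -/
def gaussState (c : ℂ) (hc : 0 < c.re) (q p : ℝ) : Mode := (memLp_gaussWave hc q p).toLp _

section

variable {c : ℂ} (hc : 0 < c.re)

lemma gaussState_coeFn (q p : ℝ) : gaussState c hc q p =ᵐ[volume] gaussWave c q p :=
  MemLp.coeFn_toLp _

attribute [irreducible] gaussState

lemma inner_gaussState (q p q' p' : ℝ) :
    ⟪gaussState c hc q p, gaussState c hc q' p'⟫_ℂ =
      Complex.exp (-((starRingEnd ℂ) c * q ^ 2 + c * q' ^ 2) / 2 +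
        ((starRingEnd ℂ) c * q + c * q' + (p' - p) * Complex.I) ^ 2 / (4 * c.re)) := by
  rw [← integral_normalized_cexp_quadratic hc, L2.inner_def]
  refine integral_congr_ae ?_
  filter_upwards [gaussState_coeFn hc q p, gaussState_coeFn hc q' p'] with x h1 h2
  rw [h1, h2, RCLike.inner_apply', mul_comm]
  change gaussWave c q' p' x * (starRingEnd ℂ) (gaussWave c q p x) = _
  rw [gaussWave_mul_conj hc]
  congr 2
  have h3 : (c.re : ℂ) = (c + (starRingEnd ℂ) c) / 2 := by rw [Complex.add_conj]; simp
  rw [h3]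
  ring

/-- A pure position shift produces a real overlap that is Gaussian in the separation. The ratio
`|c|² / Re c` is the only feature of the probe that enters the final bound. -/
lemma inner_gaussState_same_momentum (q q' p : ℝ) :
    ⟪gaussState c hc q p, gaussState c hc q' p⟫_ℂ =
      (Real.exp (-(Complex.normSq c / (4 * c.re)) * (q - q') ^ 2) : ℝ) := by
  rw [inner_gaussState, Complex.ofReal_exp]
  congr 1
  have h0 : (c.re : ℂ) ≠ 0 := by exact_mod_cast hc.ne'
  have h3 : (starRingEnd ℂ) c = 2 * c.re - c := by
    have := Complex.add_conj c
    push_cast at this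
    linear_combination this
  push_cast
  rw [Complex.normSq_eq_conj_mul_self, h3]
  field_simp
  ring

lemma norm_gaussState (q p : ℝ) : ‖gaussState c hc q p‖ = 1 := by
  have h := inner_gaussState_same_momentum hc q q p
  rw [inner_self_eq_norm_sq_to_K] at h
  have h2 : ‖gaussState c hc q p‖ ^ 2 = 1 := by
    have : ((‖gaussState c hc q p‖ ^ 2 : ℝ) : ℂ) = 1 := by
      push_cast
      refine Eq.trans ?_ (h.trans (by simp))
      rfl
    exact_mod_cast this
  nlinarith [norm_nonneg (gaussState c hc q p)]

/-- For unit vectors the squared distance is `2 - 2 Re` of the overlap, and the overlap is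
explicitly continuous. -/
lemma continuous_gaussState : Continuous fun z : ℝ × ℝ => gaussState c hc z.1 z.2 := by
  rw [continuous_iff_continuousAt]
  intro z
  rw [ContinuousAt, tendsto_iff_norm_sub_tendsto_zero]
  have h : ∀ y : ℝ × ℝ, ‖gaussState c hc y.1 y.2 - gaussState c hc z.1 z.2‖ =
      √(2 - 2 * (⟪gaussState c hc y.1 y.2, gaussState c hc z.1 z.2⟫_ℂ).re) := fun y => by
    rw [← Real.sqrt_sq (norm_nonneg (_ - _)), @norm_sub_sq ℂ, norm_gaussState, norm_gaussState]
    congr 1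
    simp only [RCLike.re_to_complex]
    ring
  have h2 : Continuous fun y : ℝ × ℝ =>
      √(2 - 2 * (⟪gaussState c hc y.1 y.2, gaussState c hc z.1 z.2⟫_ℂ).re) := by
    simp only [inner_gaussState]
    fun_prop
  simp only [h]
  have h3 := h2.tendsto z
  simp only [← h z, sub_self, norm_zero] at h3
  exact h3

/-- The family is closed under displacement up to a phase, and the phase drops out of all outcome
probabilities. -/
lemma displacement_gaussState (α : ℂ) (q p : ℝ) : ∃ θ : ℝ,
    displacement α (gaussState c hc q p) = Complex.exp (θ * Complex.I) •
      gaussState c hc (q + √2 * α.re) (p + √2 * α.im) := by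
  refine ⟨-(√2 * α.re * p + α.re * α.im), Lp.ext ?_⟩
  filter_upwards [displacement_coeFn α (gaussState c hc q p),
    (quasiMeasurePreserving_sub_const (√2 * α.re)).ae (gaussState_coeFn hc q p),
    Lp.coeFn_smul (Complex.exp ((-(√2 * α.re * p + α.re * α.im) : ℝ) * Complex.I))
      (gaussState c hc (q + √2 * α.re) (p + √2 * α.im)),
    gaussState_coeFn hc (q + √2 * α.re) (p + √2 * α.im)] with x h1 h2 h3 h4
  rw [h1, h2, h3, Pi.smul_apply, h4, smul_eq_mul, gaussWave, gaussWave, mul_left_comm,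
    mul_left_comm (Complex.exp _), ← Complex.exp_add, ← Complex.exp_add]
  congr 2
  push_cast
  ring

lemma inner_gaussState_displaced_parity (q₀ p₀ q p : ℝ) :
    ⟪gaussState c hc q₀ p₀, displaced parity (⟨q / √2, p / √2⟩ : ℂ) (gaussState c hc q₀ p₀)⟫_ℂ
      = (Real.exp (-c.re * (q - q₀) ^ 2 - (p - p₀ + c.im * (q - q₀)) ^ 2 / c.re) : ℝ) := by
  have h0 : (c.re : ℂ) ≠ 0 := by exact_mod_cast hc.ne'
  have hre : c = c.re + c.im * Complex.I := (Complex.re_add_im c).symm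
  have hcj : (starRingEnd ℂ) c = 2 * c.re - c := by
    have := Complex.add_conj c
    push_cast at this
    linear_combination this
  have hI : Complex.I ^ 2 = -1 := Complex.I_sq
  rw [inner_displaced_parity (gaussState_coeFn hc q₀ p₀)]
  simp only [gaussWave_mul_conj hc, mul_left_comm (Complex.exp _), ← Complex.exp_add]
  have h1 : ∀ y : ℝ, (2 * p * (y - q) : ℝ) * Complex.I +
      (-c * (((2 * q - y : ℝ) : ℂ) - q₀) ^ 2 / 2 + p₀ * ((2 * q - y : ℝ) : ℂ) * Complex.I +
        (-(starRingEnd ℂ) c * ((y : ℂ) - q₀) ^ 2 / 2 - p₀ * y * Complex.I))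
      = -c.re * y ^ 2 + (2 * p * Complex.I - 2 * p₀ * Complex.I + c * (2 * q - q₀)
          + (starRingEnd ℂ) c * q₀) * y
        + (-2 * p * q * Complex.I - c * (2 * q - q₀) ^ 2 / 2 + 2 * p₀ * q * Complex.I
          - (starRingEnd ℂ) c * q₀ ^ 2 / 2) := fun y => by
    rw [hcj]
    push_cast
    ring
  simp only [h1]
  rw [integral_normalized_cexp_quadratic hc, Complex.ofReal_exp]
  congr 1
  rw [hcj]
  push_cast
  generalize (c.re : ℂ) = A at *
  generalize (c.im : ℂ) = B at *
  rw [hre]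
  field_simp
  ring_nf
  simp only [hI]
  ring

end

lemma squeeze_vacuum (r : ℝ) (h : 0 < (((Real.exp (2 * r) : ℝ) : ℂ)).re) :
    squeeze r vacuum = gaussState (Real.exp (2 * r) : ℝ) h 0 0 := by
  refine Lp.ext ?_
  have h1 := affineComp_coeFn (Real.exp r) 0 (Real.exp_pos r).ne'
    (fun _ => ((Real.exp (r / 2) : ℝ) : ℂ)) measurable_const
    (fun _ => by
      rw [Complex.norm_real, Real.norm_of_nonneg (Real.exp_pos _).le,
        abs_of_pos (Real.exp_pos _), Real.exp_half]) vacuum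
  have h2 := (quasiMeasurePreserving_affine (Real.exp_pos r).ne' 0).ae
    (MemLp.coeFn_toLp memLp_vacuum)
  filter_upwards [h1, h2, gaussState_coeFn h 0 0] with x g1 g2 g3
  refine g1.trans ?_
  rw [g3]
  rw [vacuum, g2, gaussWave]
  have h4 : (Real.exp (2 * r) / Real.pi) ^ (1 / 4 : ℝ)
      = Real.exp (r / 2) * Real.pi ^ (-(1 / 4) : ℝ) := by
    rw [Real.div_rpow (Real.exp_pos _).le Real.pi_pos.le, ← Real.exp_mul,
      Real.rpow_neg Real.pi_pos.le]
    congr 2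
    ring
  rw [Complex.ofReal_re, h4]
  push_cast
  rw [mul_assoc]
  congr 3
  rw [two_mul, Complex.exp_add]
  simp
  ring

/-! ### Gaussian states as mixtures of pure Gaussian states -/

lemma integral_normalized_exp_quadratic {r : ℝ} (hr : 0 < r) (l k : ℝ) :
    ∫ x : ℝ, √(r / Real.pi) * Real.exp (-r * x ^ 2 + l * x + k) = Real.exp (k + l ^ 2 / (4 * r)) := by
  have h := integral_normalized_cexp_quadratic hr l k
  apply Complex.ofReal_injective
  rw [← integral_complex_ofReal]
  push_cast
  exact h

/-- Convolution of Gaussians by completing the square. The degenerate case `v = 0` is a Dirac mass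
and is needed for pure states. -/
lemma integral_exp_neg_sq_gaussianReal {k : ℝ} (hk : 0 < k) (v : ℝ≥0) (y : ℝ) :
    ∫ s, Real.exp (-k * (y - s) ^ 2) ∂gaussianReal 0 v
      = (√(1 + 2 * k * v))⁻¹ * Real.exp (-k * y ^ 2 / (1 + 2 * k * v)) := by
  rcases eq_or_ne v 0 with rfl | hv
  · simp
  have hv' : (0 : ℝ) < v := by positivity
  have hr : 0 < 1 / (2 * v) + k := by positivity
  have hx : (-k * y ^ 2) + (2 * k * y) ^ 2 / (4 * (1 / (2 * v) + k))
      = -k * y ^ 2 / (1 + 2 * k * v) := by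
    field_simp
    ring
  rw [integral_gaussianReal_eq_integral_smul hv, ← hx, ← integral_normalized_exp_quadratic hr,
    ← integral_const_mul]
  refine integral_congr_ae (Filter.Eventually.of_forall fun s => ?_)
  have h1 : (√(2 * Real.pi * v))⁻¹ = (√(1 + 2 * k * v))⁻¹ * √((1 / (2 * v) + k) / Real.pi) := by
    rw [← Real.sqrt_inv, ← Real.sqrt_inv, ← Real.sqrt_mul (by positivity)]
    congr 1
    field_simp
  simp only [gaussianPDFReal, smul_eq_mul]
  rw [h1, mul_assoc, mul_assoc, mul_assoc, ← Real.exp_add]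
  congr 3
  field_simp
  ring

lemma squeezedCov_det (r φ n : ℝ) : (squeezedCov r φ n).det = (2 * n + 1) ^ 2 := by
  rw [squeezedCov, Matrix.det_smul, Matrix.det_fin_two_of, Fintype.card_fin]
  have h1 := Real.cosh_sq (2 * r)
  have h2 := Real.sin_sq_add_cos_sq φ
  linear_combination (2 * n + 1) ^ 2 * h1 - (2 * n + 1) ^ 2 * Real.sinh (2 * r) ^ 2 * h2

lemma squeezedCov_inv_quadratic (r φ : ℝ) {n : ℝ} (hn : 0 ≤ n) (x : Fin 2 → ℝ) :
    x ⬝ᵥ (squeezedCov r φ n)⁻¹.mulVec x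
      = ((Real.cosh (2 * r) + Real.cos φ * Real.sinh (2 * r)) * x 0 ^ 2
          - 2 * (Real.sin φ * Real.sinh (2 * r)) * (x 0 * x 1)
          + (Real.cosh (2 * r) - Real.cos φ * Real.sinh (2 * r)) * x 1 ^ 2) / (2 * n + 1) := by
  have hN : 2 * n + 1 ≠ 0 := by positivity
  rw [Matrix.inv_def, squeezedCov_det, squeezedCov, Matrix.adjugate_fin_two]
  simp [Matrix.mulVec, dotProduct, Fin.sum_univ_two]
  field_simp
  ring

/-- The entry is the convex combination of `exp (2r)` and `exp (-2r)` with weights `(1 ± cos φ)/2`.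
-/
lemma squeezedCov_apply_one_one_pos (r φ : ℝ) :
    0 < Real.cosh (2 * r) + Real.cos φ * Real.sinh (2 * r) := by
  rw [Real.cosh_eq, Real.sinh_eq]
  have h1 := Real.neg_one_le_cos φ
  have h2 := Real.cos_le_one φ
  have h3 := Real.exp_pos (2 * r)
  have h4 := Real.exp_pos (-(2 * r))
  rcases le_total 0 (Real.cos φ) with h | h
  · nlinarith [mul_nonneg (sub_nonneg.2 h2) h4.le, mul_nonneg h h3.le]
  · nlinarith [mul_nonneg (neg_nonneg.2 h) h4.le, mul_nonneg (neg_le_iff_add_nonneg.1 h1) h3.le]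

/-- The sign condition is used here: for `r < 0` and `φ = π` the entry is `exp (-2r) > exp (2r)`. -/
lemma squeezedCov_apply_one_one_le {r φ : ℝ} (h : 0 ≤ r ∨ φ = 0) :
    Real.cosh (2 * r) + Real.cos φ * Real.sinh (2 * r) ≤ Real.exp (2 * r) := by
  rcases h with h | rfl
  · rw [← Real.cosh_add_sinh]
    have h1 : 0 ≤ Real.sinh (2 * r) := Real.sinh_nonneg_iff.2 (by positivity)
    nlinarith [Real.cos_le_one φ]
  · simp [Real.cosh_add_sinh]

lemma isVersion_gaussState {Y : Type*} [MeasurableSpace Y] {c : ℂ} (hc : 0 < c.re) {q p : Y → ℝ}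
    (hq : Measurable q) (hp : Measurable p) :
    IsVersion (fun y x => gaussWave c (q y) (p y) x) fun y => gaussState c hc (q y) (p y) where
  measurable := measurable_gaussWave c (hq.comp measurable_fst) (hp.comp measurable_fst)
    measurable_snd
  ae_eq _ := gaussState_coeFn hc _ _

lemma stronglyMeasurable_gaussState {Y : Type*} [MeasurableSpace Y] {c : ℂ} (hc : 0 < c.re)
    {q p : Y → ℝ} (hq : Measurable q) (hp : Measurable p) :
    StronglyMeasurable fun y => gaussState c hc (q y) (p y) := by
  have h1 : StronglyMeasurable fun y => (q y, p y) := (hq.prodMk hp).stronglyMeasurable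
  have h2 := (continuous_gaussState hc).comp_stronglyMeasurable h1
  exact h2

/-- A Gaussian state is a mixture, along a line in phase space, of pure Gaussian states whose
position-shift quantum Fisher information is the one of the mixed state. -/
lemma IsGaussianState.exists_isMixture {ρ : Mode →L[ℂ] Mode} {m : Fin 2 → ℝ} {r φ n : ℝ}
    (hn : 0 ≤ n) (h : IsGaussianState ρ m (squeezedCov r φ n)) :
    ∃ (c : ℂ) (hc : 0 < c.re) (b : ℝ) (v : ℝ≥0),
      Complex.normSq c / c.re
        = (Real.cosh (2 * r) + Real.cos φ * Real.sinh (2 * r)) / (2 * n + 1) ∧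
      IsMixture ρ (gaussianReal 0 v) fun s => gaussState c hc (m 0 + b * s) (m 1 + s) := by
  have hD := squeezedCov_apply_one_one_pos r φ
  have hq := squeezedCov_inv_quadratic r φ hn
  have hdet := squeezedCov_det r φ n
  have hAD : (Real.cosh (2 * r) - Real.cos φ * Real.sinh (2 * r)) *
      (Real.cosh (2 * r) + Real.cos φ * Real.sinh (2 * r))
        = 1 + (Real.sin φ * Real.sinh (2 * r)) ^ 2 := by
    have h1 := Real.cosh_sq (2 * r)
    have h2 := Real.sin_sq_add_cos_sq φ
    linear_combination h1 - Real.sinh (2 * r) ^ 2 * h2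
  generalize Real.cosh (2 * r) + Real.cos φ * Real.sinh (2 * r) = D at *
  generalize Real.cosh (2 * r) - Real.cos φ * Real.sinh (2 * r) = A at *
  generalize Real.sin φ * Real.sinh (2 * r) = B at *
  have hN1 : 1 ≤ 2 * n + 1 := by linarith
  generalize 2 * n + 1 = N at *
  have hN : 0 < N := by linarith
  have hS : 0 < B ^ 2 + N ^ 2 := by positivity
  -- Since `A D - B² = 1`, the form of `Γ⁻¹` is `(D x - B p)²/(N D) + p²/(N D)`. Keeping the first
  -- square, determinant one (purity) forces the coefficient `N/D` on `p²`. Smearing `p` with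
  -- variance `v` must turn `N/D` into `1/(N D)`, that is `1 + 2 (N/D) v = N²`.
  obtain ⟨v, hv⟩ : ∃ v : ℝ≥0, (v : ℝ) = D * (N ^ 2 - 1) / (2 * N) :=
    ⟨⟨_, div_nonneg (mul_nonneg hD.le (by nlinarith)) (by positivity)⟩, rfl⟩
  -- Obtained by comparing `(D x - B p)²/(N D) + (N/D) p²` with the pure form `Re c x² + (p + Im c
  -- x)²/Re c`.
  obtain ⟨c, hcre, hcim⟩ : ∃ c : ℂ, c.re = N * D / (B ^ 2 + N ^ 2) ∧
      c.im = -(D * B) / (B ^ 2 + N ^ 2) := ⟨⟨_, _⟩, rfl, rfl⟩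
  have hc : 0 < c.re := by
    rw [hcre]
    positivity
  -- The slope `B/D` is the direction along which `D x - B p` is constant, so mixing leaves the
  -- first square untouched.
  refine ⟨c, hc, B / D, v, ?_, ?_⟩
  · rw [Complex.normSq_apply, hcre, hcim]
    field_simp
    ring
  obtain ⟨ι, _, _, _, ψ, hψ⟩ := h.1.exists_isMixture
  obtain ⟨Ψ, hΨ⟩ := exists_isVersion ψ
  have hm0 : Measurable fun s : ℝ => m 0 + B / D * s := by fun_prop
  have hm1 : Measurable fun s : ℝ => m 1 + s := by fun_prop
  refine hψ.of_wigner_eq ?_ hΨ (isVersion_gaussState hc hm0 hm1) fun q p => ?_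
  · exact MemLp.of_bound (stronglyMeasurable_gaussState hc hm0 hm1).aestronglyMeasurable 1
      (Filter.Eventually.of_forall fun s => (norm_gaussState hc _ _).le)
  have hT := HasTrace.unique
    (hψ.hasTrace_comp' (BosonicMode.displaced parity (⟨q / √2, p / √2⟩ : ℂ))) (h.2 ![q, p])
  rw [hT]
  simp only [inner_gaussState_displaced_parity hc]
  rw [integral_complex_ofReal, hq, hdet, Real.sqrt_sq hN.le]
  congr 1
  have hexp : ∀ s, -c.re * (q - (m 0 + B / D * s)) ^ 2
      - (p - (m 1 + s) + c.im * (q - (m 0 + B / D * s))) ^ 2 / c.re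
      = -(D * (q - m 0) - B * (p - m 1)) ^ 2 / (N * D) + -(N / D) * ((p - m 1) - s) ^ 2 :=
      fun s => by
    rw [hcre, hcim]
    field_simp
    ring
  simp only [hexp, Real.exp_add, integral_const_mul]
  rw [integral_exp_neg_sq_gaussianReal (by positivity)]
  have h1 : 1 + 2 * (N / D) * v = N ^ 2 := by
    rw [hv]
    field_simp
    ring
  have hA : A = (1 + B ^ 2) / D := by rw [eq_div_iff hD.ne', hAD]
  rw [h1, Real.sqrt_sq hN.le, mul_left_comm (Real.exp _), ← Real.exp_add, hA, ← mul_div_assoc,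
    mul_div_mul_left _ _ Real.pi_ne_zero, div_eq_inv_mul]
  congr 2
  simp only [Pi.sub_apply, Matrix.cons_val_zero, Matrix.cons_val_one, Matrix.cons_val_fin_one]
  field_simp
  ring

lemma isMixture_squeezedVacuum (r : ℝ) (h : 0 < (((Real.exp (2 * r) : ℝ) : ℂ)).re) :
    IsMixture (squeezedVacuum r) (Measure.dirac ())
      fun _ => gaussState (Real.exp (2 * r) : ℝ) h 0 0 := by
  rw [← squeeze_vacuum]
  exact isMixture_rankOne _

lemma isGaussianState_squeezedVacuum (r : ℝ) :
    IsGaussianState (squeezedVacuum r) 0 (squeezedCov r 0 0) := by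
  have h : 0 < (((Real.exp (2 * r) : ℝ) : ℂ)).re := Real.exp_pos _
  have hm := isMixture_squeezedVacuum r h
  refine ⟨⟨InnerProductSpace.isPositive_rankOne_self _, ?_⟩, fun x => ?_⟩
  · have h1 : HasTrace _ _ := hm.hasTrace_comp (ContinuousLinearMap.id ℂ Mode)
    rw [ContinuousLinearMap.id_comp] at h1
    have h2 : ∫ _ : Unit, ⟪gaussState _ h 0 0, ContinuousLinearMap.id ℂ Mode
        (gaussState _ h 0 0)⟫_ℂ ∂Measure.dirac () = 1 := by
      simp [inner_self_eq_norm_sq_to_K, norm_gaussState]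
    rw [h2] at h1
    exact fun {ι} e => @h1 ι e
  · have h1 : HasTrace _ _ :=
      hm.hasTrace_comp' (displaced parity (⟨x 0 / √2, x 1 / √2⟩ : ℂ))
    intro ι e
    convert h1 e using 1
    rw [eq_comm]
    beta_reduce
    rw [integral_dirac, inner_gaussState_displaced_parity, squeezedCov_det,
      squeezedCov_inv_quadratic r 0 le_rfl]
    congr 1
    simp only [Real.cos_zero, Real.sin_zero, one_mul, Real.cosh_add_sinh, Real.cosh_sub_sinh,
      Complex.ofReal_re, Complex.ofReal_im, Pi.sub_apply, Pi.zero_apply]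
    have := Real.pi_ne_zero
    simp
    field_simp
    congr 1
    rw [Real.exp_neg]
    field_simp
    ring

/-! ### The Bayesian Cramér–Rao bound for a pure state and finitely many outcomes -/

lemma gaussianPDFReal_mul_gaussianPDFReal (μ : ℝ) {v : ℝ≥0} (hv : v ≠ 0) (a b : ℝ) :
    gaussianPDFReal μ v a * gaussianPDFReal μ v b
      = (Real.exp (-(a - b) ^ 2 / (8 * v)) * gaussianPDFReal μ v ((a + b) / 2)) ^ 2 := by
  have hv' : (v : ℝ) ≠ 0 := by exact_mod_cast hv
  simp only [gaussianPDFReal]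
  rw [mul_mul_mul_comm, ← Real.exp_add, mul_left_comm, mul_pow, ← sq, ← Real.exp_add,
    ← Real.exp_nat_mul]
  congr 2
  push_cast
  field_simp
  ring

/-- The prior contributes a factor of the same shape as the overlap of states, with its classical
Fisher information `1/v` in the role of `F`. -/
lemma sqrt_gaussianPDFReal_mul (μ : ℝ) {v : ℝ≥0} (hv : v ≠ 0) (a b : ℝ) :
    √(gaussianPDFReal μ v a) * √(gaussianPDFReal μ v b)
      = Real.exp (-(a - b) ^ 2 / (8 * v)) * gaussianPDFReal μ v ((a + b) / 2) := by
  rw [← Real.sqrt_mul (gaussianPDFReal_nonneg _ _ _), gaussianPDFReal_mul_gaussianPDFReal μ hv,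
    Real.sqrt_sq (mul_nonneg (Real.exp_pos _).le (gaussianPDFReal_nonneg _ _ _))]

lemma integrable_gaussianReal_iff (μ : ℝ) {v : ℝ≥0} (hv : v ≠ 0) (f : ℝ → ℝ) :
    Integrable f (gaussianReal μ v) ↔ Integrable fun a => gaussianPDFReal μ v a * f a := by
  rw [gaussianReal_of_var_ne_zero μ hv, integrable_withDensity_iff_integrable_smul'
    (measurable_gaussianPDF μ v) (Filter.Eventually.of_forall fun _ => gaussianPDF_lt_top)]
  simp [toReal_gaussianPDF]

lemma integrable_re_inner {X : Type*} [MeasurableSpace X] {ν : Measure X} {χ φ : X → Mode}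
    (hχ : MemLp χ 2 ν) (hφ : MemLp φ 2 ν) : Integrable (fun x => (⟪χ x, φ x⟫_ℂ).re) ν :=
  (integrable_inner_of_memLp_two hχ hφ).re

section Core

variable {χ : ℝ → Mode} {F μ : ℝ} {v : ℝ≥0}

/-- The square root of the prior density times the family of vectors. -/
def weighted (μ : ℝ) (v : ℝ≥0) (χ : ℝ → Mode) (a : ℝ) : Mode :=
  ((√(gaussianPDFReal μ v a) : ℝ) : ℂ) • χ a

lemma re_inner_weighted (B : Mode →L[ℂ] Mode) (a b : ℝ) :
    (⟪weighted μ v χ a, B (weighted μ v χ b)⟫_ℂ).re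
      = √(gaussianPDFReal μ v a) * √(gaussianPDFReal μ v b) * (⟪χ a, B (χ b)⟫_ℂ).re := by
  rw [weighted, weighted, map_smul, inner_smul_left, inner_smul_right, Complex.conj_ofReal,
    ← mul_assoc, ← Complex.ofReal_mul, Complex.re_ofReal_mul]

/-- The choice `y = 1`, `t = 0` gives the weighted family itself, and `t = 1` gives its product with
the estimation error. -/
lemma memLp_weighted (hv : v ≠ 0) (hc : Continuous χ) (hn : ∀ a, ‖χ a‖ = 1) (y t : ℝ) :
    MemLp (fun a => ((y - t * a : ℝ) : ℂ) • weighted μ v χ a) 2 volume := by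
  have hm : StronglyMeasurable fun a => ((y - t * a : ℝ) : ℂ) • weighted μ v χ a := by
    have h1 : Measurable fun a => ((√(gaussianPDFReal μ v a) : ℝ) : ℂ) :=
      Complex.measurable_ofReal.comp (measurable_gaussianPDFReal μ v).sqrt
    have h2 : Measurable fun a : ℝ => ((y - t * a : ℝ) : ℂ) := by fun_prop
    exact h2.stronglyMeasurable.smul (h1.stronglyMeasurable.smul hc.stronglyMeasurable)
  rw [memLp_two_iff_integrable_sq_norm hm.aestronglyMeasurable]
  have h : MemLp (fun a : ℝ => y - t * a) 2 (gaussianReal μ v) :=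
    (memLp_const y).sub ((memLp_id_gaussianReal 2).const_mul t)
  refine ((integrable_gaussianReal_iff μ hv _).1 h.integrable_sq).congr
    (Filter.Eventually.of_forall fun a => ?_)
  simp only [weighted, norm_smul, Complex.norm_real, hn, mul_one, mul_pow, Real.norm_eq_abs,
    sq_abs, Real.sq_sqrt (gaussianPDFReal_nonneg μ v a)]
  ring

/-- Both exponents are quadratic in `k - l`, so the informations of prior and probe add; the
remaining midpoint density integrates to one. -/
lemma integral_re_inner_weighted (hv : v ≠ 0)
    (hχ : ∀ a b, (⟪χ a, χ b⟫_ℂ).re = Real.exp (-(F / 8) * (a - b) ^ 2)) (k l : ℝ) :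
    ∫ a, (⟪weighted μ v χ (a + k), weighted μ v χ (a + l)⟫_ℂ).re
      = Real.exp (-((1 / v + F) / 8) * (k - l) ^ 2) := by
  have h1 : ∀ a, (⟪weighted μ v χ (a + k), weighted μ v χ (a + l)⟫_ℂ).re
      = Real.exp (-((1 / v + F) / 8) * (k - l) ^ 2)
        * gaussianPDFReal μ v (a + (k + l) / 2) := fun a => by
    have h := re_inner_weighted (μ := μ) (v := v) (χ := χ) (ContinuousLinearMap.id ℂ Mode)
      (a + k) (a + l)
    simp only [ContinuousLinearMap.id_apply] at h
    rw [h, hχ, sqrt_gaussianPDFReal_mul μ hv, mul_right_comm, ← Real.exp_add]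
    have hv' : (v : ℝ) ≠ 0 := by exact_mod_cast hv
    congr 2
    · field_simp
      ring
    · ring
  simp only [h1]
  rw [integral_const_mul, integral_add_right_eq_self (gaussianPDFReal μ v),
    integral_gaussianPDFReal_eq_one μ hv, mul_one]

lemma re_inner_sub_smul {B : Mode →L[ℂ] Mode} (hB : B.IsPositive) (f g : Mode) (t : ℝ) :
    (⟪f - (t : ℂ) • g, B (f - (t : ℂ) • g)⟫_ℂ).re
      = (⟪f, B f⟫_ℂ).re - 2 * t * (⟪f, B g⟫_ℂ).re + t ^ 2 * (⟪g, B g⟫_ℂ).re := by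
  have h1 : (⟪g, B f⟫_ℂ).re = (⟪f, B g⟫_ℂ).re := by
    have : ⟪B g, f⟫_ℂ = ⟪g, B f⟫_ℂ := hB.isSymmetric g f
    rw [← this, ← inner_conj_symm, Complex.conj_re]
  simp only [map_sub, map_smul, inner_sub_left, inner_sub_right, inner_smul_left,
    inner_smul_right, Complex.conj_ofReal, Complex.sub_re, Complex.re_ofReal_mul, h1]
  ring

/-- Integration by shifting: the discrete analogue of `∫ (y - a) d/da ⟨u_a, B u_a⟩ da`. -/
lemma integral_shift_identity {u : ℝ → Mode} {B : Mode →L[ℂ] Mode} (hB : B.IsPositive)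
    (hu : ∀ y t : ℝ, MemLp (fun a => ((y - t * a : ℝ) : ℂ) • u a) 2 volume) (y h : ℝ) :
    ∫ a, (⟪((y - a : ℝ) : ℂ) • u a, B (u (a + h) - u (a - h))⟫_ℂ).re
      = h * ∫ a, (⟪u a, B (u (a + h))⟫_ℂ).re := by
  have hu0 : MemLp u 2 volume := by simpa using hu 1 0
  have hu1 : MemLp (fun a => ((y - a : ℝ) : ℂ) • u a) 2 volume := by simpa using hu y 1
  have hs : ∀ k : ℝ, MemLp (fun a => B (u (a + k))) 2 volume := fun k =>
    memLp_clm_comp (hu0.comp_measurePreserving (measurePreserving_add_right volume k)) B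
  have i1 := fun k => integrable_re_inner hu1 (hs k)
  have i2 := integrable_re_inner hu0 (hs h)
  have hsym : ∀ f g, (⟪g, B f⟫_ℂ).re = (⟪f, B g⟫_ℂ).re := fun f g => by
    have : ⟪B g, f⟫_ℂ = ⟪g, B f⟫_ℂ := hB.isSymmetric g f
    rw [← this, ← inner_conj_symm, Complex.conj_re]
  -- Translating `a` by `h` and using symmetry of `B` exchanges the two vectors; the weight `y - a`
  -- drops by `h`, which is the whole difference.
  have e1 : ∫ a, (⟪((y - a : ℝ) : ℂ) • u a, B (u (a + -h))⟫_ℂ).re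
      = (∫ a, (⟪((y - a : ℝ) : ℂ) • u a, B (u (a + h))⟫_ℂ).re)
        - h * ∫ a, (⟪u a, B (u (a + h))⟫_ℂ).re := by
    rw [← integral_add_right_eq_self _ h, ← integral_const_mul]
    rw [← integral_sub (i1 h) (i2.const_mul h)]
    refine integral_congr_ae (Filter.Eventually.of_forall fun a => ?_)
    simp only [inner_smul_left, Complex.conj_ofReal, Complex.re_ofReal_mul,
      add_neg_cancel_right]
    rw [hsym]
    ring
  have i3 := i1 (-h)
  simp only [← sub_eq_add_neg] at e1 i3
  simp only [map_sub, inner_sub_right, Complex.sub_re]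
  rw [integral_sub (i1 h) i3, e1]
  ring

/-- Positivity of each effect on `(yᵢ - a) u a - t (u (a+h) - u (a-h))` gives a quadratic inequality
in `t`. In the sum over outcomes the effects disappear from the linear and quadratic coefficients by
completeness, leaving explicit Gaussians in `h`. -/
lemma bayes_bound_of_finite {ι : Type*} [Fintype ι] {E : ι → Mode →L[ℂ] Mode}
    (hE : ∀ i, (E i).IsPositive) (hE1 : ∑ i, E i = ContinuousLinearMap.id ℂ Mode) (y : ι → ℝ)
    (hv : v ≠ 0) (hF : 0 ≤ F) (hc : Continuous χ) (hn : ∀ a, ‖χ a‖ = 1)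
    (hχ : ∀ a b, (⟪χ a, χ b⟫_ℂ).re = Real.exp (-(F / 8) * (a - b) ^ 2)) :
    (1 / (v : ℝ) + F)⁻¹
      ≤ ∑ i, ∫ a, (y i - a) ^ 2 * (⟪χ a, E i (χ a)⟫_ℂ).re ∂gaussianReal μ v := by
  set u := weighted μ v χ with hu_def
  have hu : ∀ y t : ℝ, MemLp (fun a => ((y - t * a : ℝ) : ℂ) • u a) 2 volume :=
    memLp_weighted hv hc hn
  have hu0 : MemLp u 2 volume := by simpa using hu 1 0
  have hu1 : ∀ y : ℝ, MemLp (fun a => ((y - a : ℝ) : ℂ) • u a) 2 volume := fun y => by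
    simpa using hu y 1
  have hus : ∀ k : ℝ, MemLp (fun a => u (a + k)) 2 volume := fun k =>
    hu0.comp_measurePreserving (measurePreserving_add_right volume k)
  set J := 1 / (v : ℝ) + F with hJ_def
  have hv' : (0 : ℝ) < v := by positivity
  have hJ : 0 < J := by positivity
  set V := ∑ i, ∫ a, (y i - a) ^ 2 * (⟪χ a, E i (χ a)⟫_ℂ).re ∂gaussianReal μ v with hV_def
  have hC := integral_re_inner_weighted (μ := μ) hv hχ
  have hsum : ∀ f g : Mode, ∑ i, (⟪f, E i g⟫_ℂ).re = (⟪f, g⟫_ℂ).re := fun f g => by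
    rw [← Complex.re_sum, ← inner_sum, ← sum_apply, hE1]
    rfl
  have key : ∀ h t : ℝ, 0 ≤ V - 2 * t * (h * Real.exp (-(J / 8) * h ^ 2))
      + t ^ 2 * (2 - 2 * Real.exp (-(J / 8) * (2 * h) ^ 2)) := by
    intro h t
    have hη : MemLp (fun a => u (a + h) - u (a - h)) 2 volume := by
      exact (hus h).sub (by simpa only [sub_eq_add_neg] using hus (-h))
    have hi : ∀ i, 0 ≤ (∫ a, (y i - a) ^ 2 * (⟪χ a, E i (χ a)⟫_ℂ).re ∂gaussianReal μ v)
        - 2 * t * (h * ∫ a, (⟪u a, E i (u (a + h))⟫_ℂ).re)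
        + t ^ 2 * ∫ a, (⟪u (a + h) - u (a - h), E i (u (a + h) - u (a - h))⟫_ℂ).re := fun i => by
      have i1 := integrable_re_inner (hu1 (y i)) (memLp_clm_comp (hu1 (y i)) (E i))
      have i2 := integrable_re_inner (hu1 (y i)) (memLp_clm_comp hη (E i))
      have i3 := integrable_re_inner hη (memLp_clm_comp hη (E i))
      have h1 : 0 ≤ ∫ a, (⟪((y i - a : ℝ) : ℂ) • u a - (t : ℂ) • (u (a + h) - u (a - h)),
          E i (((y i - a : ℝ) : ℂ) • u a - (t : ℂ) • (u (a + h) - u (a - h)))⟫_ℂ).re :=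
        integral_nonneg fun a => (hE i).re_inner_nonneg_right _
      simp only [re_inner_sub_smul (hE i)] at h1
      have i12 : Integrable fun a => (⟪((y i - a : ℝ) : ℂ) • u a,
          E i (((y i - a : ℝ) : ℂ) • u a)⟫_ℂ).re - 2 * t * (⟪((y i - a : ℝ) : ℂ) • u a,
            E i (u (a + h) - u (a - h))⟫_ℂ).re := i1.sub (i2.const_mul _)
      rw [integral_add i12 (i3.const_mul _), integral_sub i1 (i2.const_mul _), integral_const_mul, integral_const_mul,
        integral_shift_identity (hE i) hu] at h1
      convert h1 using 1
      congr 2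
      rw [integral_gaussianReal_eq_integral_smul hv]
      refine integral_congr_ae (Filter.Eventually.of_forall fun a => ?_)
      simp only [map_smul, inner_smul_left, inner_smul_right, Complex.conj_ofReal,
        Complex.re_ofReal_mul, hu_def, re_inner_weighted, smul_eq_mul,
        Real.mul_self_sqrt (gaussianPDFReal_nonneg μ v a)]
      ring
    have h2 := Finset.sum_nonneg fun i (_ : i ∈ Finset.univ) => hi i
    rw [Finset.sum_add_distrib, Finset.sum_sub_distrib, ← Finset.mul_sum, ← Finset.mul_sum,
      ← Finset.mul_sum, ← hV_def,
      ← integral_finsetSum _ fun i _ => integrable_re_inner hu0 (memLp_clm_comp (hus h) (E i)),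
      ← integral_finsetSum _ fun i _ => integrable_re_inner hη (memLp_clm_comp hη (E i))] at h2
    simp only [hsum] at h2
    have h3 : ∫ a, (⟪u a, u (a + h)⟫_ℂ).re = Real.exp (-(J / 8) * h ^ 2) := by
      have h0 := hC 0 h
      simp only [add_zero, zero_sub, neg_sq] at h0
      exact h0
    have h4 : ∫ a, (⟪u (a + h) - u (a - h), u (a + h) - u (a - h)⟫_ℂ).re
        = 2 - 2 * Real.exp (-(J / 8) * (2 * h) ^ 2) := by
      have hp : ∀ k l, Integrable fun a => (⟪u (a + k), u (a + l)⟫_ℂ).re := fun k l =>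
        integrable_re_inner (hus k) (hus l)
      simp only [sub_eq_add_neg _ h]
      simp only [inner_sub_left, inner_sub_right, Complex.sub_re]
      have hp2 : ∀ k l k' l', Integrable fun a =>
          (⟪u (a + k), u (a + l)⟫_ℂ).re - (⟪u (a + k'), u (a + l')⟫_ℂ).re :=
        fun k l k' l' => (hp k l).sub (hp k' l')
      rw [integral_sub (hp2 _ _ _ _) (hp2 _ _ _ _), integral_sub (hp _ _) (hp _ _),
        integral_sub (hp _ _) (hp _ _), hC, hC, hC, hC]
      have e1 : (h - -h) ^ 2 = (2 * h) ^ 2 := by ring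
      have e2 : (-h - h) ^ 2 = (2 * h) ^ 2 := by ring
      rw [e1, e2]
      simp only [sub_self, ne_eq, OfNat.ofNat_ne_zero, not_false_eq_true, zero_pow, mul_zero,
        Real.exp_zero, hJ_def]
      ring
    rw [h3, h4] at h2
    exact h2
  refine le_of_forall_pos_le_add fun ε hε => ?_
  -- The finite step costs `h²/4` in the bound, so `h = 2√ε` makes the loss exactly `ε`.
  have hs : (2 * √ε) ^ 2 = 4 * ε := by rw [mul_pow, Real.sq_sqrt hε.le]; norm_num
  have hh : 0 < 2 * √ε := by positivity
  generalize 2 * √ε = h at hs hh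
  -- To leading order the quadratic is `V - 2 t h + t² J h²`, minimised at `t = 1/(J h)`.
  have k1 := key h (J⁻¹ / h)
  have b1 := Real.add_one_le_exp (-(J / 8) * h ^ 2)
  have b2 := Real.add_one_le_exp (-(J / 8) * (2 * h) ^ 2)
  have e1 : 2 * (J⁻¹ / h) * (h * Real.exp (-(J / 8) * h ^ 2))
      = 2 * J⁻¹ * Real.exp (-(J / 8) * h ^ 2) := by field_simp
  rw [e1] at k1
  have b3 : 2 * J⁻¹ * (-(J / 8) * h ^ 2 + 1) ≤ 2 * J⁻¹ * Real.exp (-(J / 8) * h ^ 2) := by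
    gcongr
  have b4 : (J⁻¹ / h) ^ 2 * (2 - 2 * Real.exp (-(J / 8) * (2 * h) ^ 2)) ≤ J⁻¹ := by
    calc _ ≤ (J⁻¹ / h) ^ 2 * (J * h ^ 2) := by
          gcongr
          linarith
      _ = J⁻¹ := by field_simp
  have e2 : 2 * J⁻¹ * (-(J / 8) * h ^ 2 + 1) = 2 * J⁻¹ - ε := by
    rw [hs]
    field_simp
    ring
  linarith

end Core

/-! ### Outcome distributions of a measurement -/

section Outcome

variable {M : Type*} [MeasurableSpace M] (E : POVM M)

lemma POVM.hasSum_re_iUnion (ψ : Mode) (A : ℕ → Set M) (hA : ∀ n, MeasurableSet (A n))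
    (hd : Pairwise (Function.onFun Disjoint A)) :
    HasSum (fun n => (⟪ψ, E.effect (A n) ψ⟫_ℂ).re) (⟪ψ, E.effect (⋃ n, A n) ψ⟫_ℂ).re :=
  Complex.hasSum_re (E.hasSum_iUnion A hA hd ψ)

lemma POVM.re_inner_nonneg {A : Set M} (hA : MeasurableSet A) (ψ : Mode) :
    0 ≤ (⟪ψ, E.effect A ψ⟫_ℂ).re := (E.isPositive A hA).re_inner_nonneg_right ψ

/-- Additivity on the constant sequence `∅` makes a constant series summable, hence zero. -/
lemma POVM.re_inner_empty (ψ : Mode) : (⟪ψ, E.effect ∅ ψ⟫_ℂ).re = 0 := by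
  have h := E.hasSum_re_iUnion ψ (fun _ => ∅) (fun _ => MeasurableSet.empty)
    (fun _ _ _ => disjoint_bot_left)
  exact (summable_const_iff _).1 h.summable

/-- The distribution of the outcomes of `E` on the pure state `ψ`. -/
def POVM.outcome (ψ : Mode) : Measure M :=
  Measure.ofMeasurable (fun A _ => ENNReal.ofReal (⟪ψ, E.effect A ψ⟫_ℂ).re)
    (by rw [E.re_inner_empty, ENNReal.ofReal_zero])
    (fun A hA hd => by
      have h := E.hasSum_re_iUnion ψ A hA hd
      rw [← h.tsum_eq, ENNReal.ofReal_tsum_of_nonneg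
        (fun n => E.re_inner_nonneg (hA n) ψ) h.summable])

lemma POVM.outcome_apply {A : Set M} (hA : MeasurableSet A) (ψ : Mode) :
    E.outcome ψ A = ENNReal.ofReal (⟪ψ, E.effect A ψ⟫_ℂ).re :=
  Measure.ofMeasurable_apply A hA

lemma re_inner_self (ψ : Mode) : (⟪ψ, ψ⟫_ℂ).re = ‖ψ‖ ^ 2 := by
  rw [inner_self_eq_norm_sq_to_K, ← RCLike.ofReal_pow]
  exact Complex.ofReal_re _

lemma POVM.outcome_univ (ψ : Mode) : E.outcome ψ Set.univ = ENNReal.ofReal (‖ψ‖ ^ 2) := by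
  rw [E.outcome_apply MeasurableSet.univ, E.effect_univ, ContinuousLinearMap.id_apply,
    re_inner_self]

instance (ψ : Mode) : IsFiniteMeasure (E.outcome ψ) :=
  ⟨by rw [E.outcome_univ]; exact ENNReal.ofReal_lt_top⟩

lemma measurable_re_inner {Y : Type*} [MeasurableSpace Y] {χ : Y → Mode}
    (hχ : StronglyMeasurable χ) (B : Mode →L[ℂ] Mode) :
    Measurable fun y => (⟪χ y, B (χ y)⟫_ℂ).re :=
  Complex.measurable_re.comp
    (hχ.inner (B.continuous.comp_stronglyMeasurable hχ)).measurable

/-- The distribution of the outcomes of `E` on a family of pure states, as a kernel. -/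
def POVM.outcomeKernel {Y : Type*} [MeasurableSpace Y] {χ : Y → Mode}
    (hχ : StronglyMeasurable χ) : Kernel Y M where
  toFun y := E.outcome (χ y)
  measurable' := by
    refine Measure.measurable_of_measurable_coe _ fun A hA => ?_
    simp only [E.outcome_apply hA]
    exact (measurable_re_inner hχ _).ennreal_ofReal

/-- Additivity of a POVM is only given for diagonal matrix elements; over `ℂ` these determine the
operator by polarization. -/
lemma POVM.sum_effect_preimage (g : SimpleFunc M ℝ) :
    ∑ y : g.range, E.effect (g ⁻¹' {(y : ℝ)}) = ContinuousLinearMap.id ℂ Mode := by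
  have hre : ∀ ψ : Mode, ∑ y : g.range, (⟪ψ, E.effect (g ⁻¹' {(y : ℝ)}) ψ⟫_ℂ).re = ‖ψ‖ ^ 2 := by
    intro ψ
    have h := g.sum_range_measure_preimage_singleton (E.outcome ψ)
    simp only [E.outcome_apply (g.measurableSet_fiber _), E.outcome_univ] at h
    rw [← ENNReal.ofReal_sum_of_nonneg
      fun y _ => E.re_inner_nonneg (g.measurableSet_fiber y) ψ] at h
    rw [Finset.sum_coe_sort g.range fun y => (⟪ψ, E.effect (g ⁻¹' {y}) ψ⟫_ℂ).re]
    exact (ENNReal.ofReal_eq_ofReal_iff (Finset.sum_nonneg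
      fun y _ => E.re_inner_nonneg (g.measurableSet_fiber y) ψ) (by positivity)).1 h
  have hpos : ContinuousLinearMap.IsPositive
      (∑ y : g.range, E.effect (g ⁻¹' {(y : ℝ)})) :=
    ContinuousLinearMap.isPositive_sum _ fun y _ => E.isPositive _ (g.measurableSet_fiber _)
  refine ContinuousLinearMap.coe_injective ((ext_inner_map _ _).1 fun ψ => ?_)
  have h2 := hre ψ
  rw [← Complex.re_sum, ← inner_sum, ← sum_apply] at h2
  have h3 : ⟪(∑ y : g.range, E.effect (g ⁻¹' {(y : ℝ)})) ψ, ψ⟫_ℂ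
      = ⟪ψ, (∑ y : g.range, E.effect (g ⁻¹' {(y : ℝ)})) ψ⟫_ℂ := hpos.isSymmetric ψ ψ
  have h4 : ((⟪ψ, (∑ y : g.range, E.effect (g ⁻¹' {(y : ℝ)})) ψ⟫_ℂ).re : ℂ)
      = ⟪ψ, (∑ y : g.range, E.effect (g ⁻¹' {(y : ℝ)})) ψ⟫_ℂ :=
    hpos.isSymmetric.coe_re_inner_self_apply ψ
  refine h3.trans (h4.symm.trans ?_)
  rw [h2]
  exact (by push_cast; rfl : ((‖ψ‖ ^ 2 : ℝ) : ℂ) = (‖ψ‖ : ℂ) ^ 2).trans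
    (inner_self_eq_norm_sq_to_K ψ).symm

end Outcome

/-! ### Born's rule for mixtures -/

section Likelihood

variable {M : Type*} [MeasurableSpace M] {E : POVM M} {ρ : Mode →L[ℂ] Mode}
  {X : Type*} [MeasurableSpace X] {ν : Measure X} {ψ : X → Mode}

lemma IsMixture.hasTrace_effect (E : POVM M) (h : IsMixture ρ ν ψ) {A : Set M} (hA : MeasurableSet A)
    (α : ℂ) : HasTrace (E.effect A ∘L BosonicMode.displaced ρ α)
      ((∫⁻ s, ENNReal.ofReal (⟪displacement α (ψ s),
        E.effect A (displacement α (ψ s))⟫_ℂ).re ∂ν).toReal : ℝ) := by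
  have hm := (h.displaced α).memLp
  have hi := integrable_re_inner hm (memLp_clm_comp hm (E.effect A))
  have hre : ∀ u : Mode, ⟪u, E.effect A u⟫_ℂ = ((⟪u, E.effect A u⟫_ℂ).re : ℂ) := fun u =>
    ((E.isPositive A hA).isSelfAdjoint.isSymmetric.coe_re_inner_self_apply u).symm
  have h1 : HasTrace _ _ := (h.displaced α).hasTrace_comp (E.effect A)
  rw [← ofReal_integral_eq_lintegral_ofReal hi (Filter.Eventually.of_forall
    fun s => E.re_inner_nonneg hA _), ENNReal.toReal_ofReal
    (integral_nonneg fun s => E.re_inner_nonneg hA _), ← integral_complex_ofReal]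
  simp only [← hre]
  exact fun {ι} e => @h1 ι e

lemma IsMixture.isLikelihood (h : IsMixture ρ ν ψ) (κ : Kernel ℂ M)
    (hκ : ∀ α A, MeasurableSet A → κ α A = ∫⁻ s, ENNReal.ofReal (⟪displacement α (ψ s),
        E.effect A (displacement α (ψ s))⟫_ℂ).re ∂ν) : IsLikelihood E ρ κ := by
  intro α A hA
  rw [measureReal_def, hκ α A hA]
  have h1 : HasTrace _ _ := h.hasTrace_effect E hA α
  exact fun {ι} e => @h1 ι e

/-- Uniqueness of the trace shows that every likelihood, not just a constructed one, is given by the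
mixture formula. -/
lemma IsLikelihood.apply {κ : Kernel ℂ M} [IsMarkovKernel κ] (hκ : IsLikelihood E ρ κ)
    (h : IsMixture ρ ν ψ) (α : ℂ) {A : Set M} (hA : MeasurableSet A) :
    κ α A = ∫⁻ s, ENNReal.ofReal (⟪displacement α (ψ s),
        E.effect A (displacement α (ψ s))⟫_ℂ).re ∂ν := by
  have hm := (h.displaced α).memLp
  have hi := integrable_re_inner hm (memLp_clm_comp hm (E.effect A))
  have h1 := HasTrace.unique (hκ α A hA) (h.hasTrace_effect E hA α)
  have h2 := Complex.ofReal_injective h1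
  rw [measureReal_def] at h2
  refine (ENNReal.toReal_eq_toReal_iff' (measure_ne_top _ _) ?_).1 h2
  rw [← ofReal_integral_eq_lintegral_ofReal hi (Filter.Eventually.of_forall
    fun s => E.re_inner_nonneg hA _)]
  exact ENNReal.ofReal_ne_top

end Likelihood

/-! ### Average posterior variance and mean square error -/

/-- The mean minimises the square error. Outside L² the right side is infinite for every `c`, so no
integrability is required. -/
lemma evariance_le_lintegral_sub_sq {Ω : Type*} [MeasurableSpace Ω] {P : Measure Ω}
    [IsProbabilityMeasure P] {X : Ω → ℝ} (hX : AEStronglyMeasurable X P) (c : ℝ) :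
    evariance X P ≤ ∫⁻ ω, ‖X ω - c‖ₑ ^ 2 ∂P := by
  by_cases h : MemLp X 2 P
  · have h1 : MemLp (fun ω => X ω - c) 2 P := h.sub (memLp_const c)
    have h2 := variance_le_expectation_sq h1.1
    rw [variance_sub_const hX] at h2
    rw [← ofReal_variance h]
    refine (ENNReal.ofReal_le_ofReal h2).trans ?_
    simp only [Pi.pow_apply]
    rw [ofReal_integral_eq_lintegral_ofReal h1.integrable_sq
      (Filter.Eventually.of_forall fun _ => sq_nonneg _)]
    refine lintegral_mono fun ω => ?_
    rw [← Real.enorm_of_nonneg (by positivity), enorm_pow]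
  · have h1 : ¬ MemLp (fun ω => X ω - c) 2 P := fun h2 => h <| by
      have h3 : MemLp (fun ω => X ω - c + c) 2 P := h2.add (memLp_const c)
      simpa using h3
    have h3 : ∫⁻ ω, ‖X ω - c‖ₑ ^ 2 ∂P = ∞ := by
      by_contra h4
      refine h1 ⟨hX.sub aestronglyMeasurable_const, ?_⟩
      have h5 := eLpNorm_nnreal_pow_eq_lintegral (f := fun ω => X ω - c) (μ := P)
        (p := 2) two_ne_zero
      by_contra h6
      rw [not_lt, top_le_iff] at h6
      simp only [ENNReal.coe_ofNat, NNReal.coe_ofNat, h6, ENNReal.rpow_ofNat] at h5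
      exact h4 (by rw [← h5]; simp)
    rw [h3]
    exact le_top

section Bayes

variable {M : Type*} [MeasurableSpace M] (κ : Kernel ℂ M) [IsMarkovKernel κ]
  (π : Measure ℂ) [IsProbabilityMeasure π]

lemma lintegral_posterior {f : ℂ × M → ℝ≥0∞} (hf : Measurable f) :
    ∫⁻ m, ∫⁻ α, f (α, m) ∂(posterior κ π m) ∂(π.bind κ) = ∫⁻ w, f w ∂(π ⊗ₘ κ) := by
  have h := Measure.lintegral_compProd (μ := π.bind κ) (κ := posterior κ π)
    (hf.comp measurable_swap)
  rw [compProd_posterior_eq_map_swap, lintegral_map (hf.comp measurable_swap) measurable_swap] at h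
  exact h.symm

lemma avgPosteriorVariance_le {g : M → ℝ} (hg : Measurable g) :
    avgPosteriorVariance κ π ≤ ∫⁻ w, ‖w.1.re - g w.2‖ₑ ^ 2 ∂(π ⊗ₘ κ) := by
  rw [← lintegral_posterior κ π (f := fun w => ‖w.1.re - g w.2‖ₑ ^ 2)
    (by fun_prop)]
  exact lintegral_mono fun m => evariance_le_lintegral_sub_sq
    Complex.measurable_re.aestronglyMeasurable (g m)

lemma eLpNorm_two_sq {Ω : Type*} [MeasurableSpace Ω] (P : Measure Ω) (f : Ω → ℝ) :
    eLpNorm f 2 P ^ 2 = ∫⁻ ω, ‖f ω‖ₑ ^ 2 ∂P := by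
  have h := eLpNorm_nnreal_pow_eq_lintegral (f := f) (μ := P) (p := 2) two_ne_zero
  simpa only [ENNReal.coe_ofNat, NNReal.coe_ofNat, ENNReal.rpow_ofNat] using h

/-- A lower bound on the mean square error of all estimators with finitely many values is a lower
bound on the average posterior variance. -/
lemma le_avgPosteriorVariance (hπ : MemLp Complex.re 2 π) {B : ℝ≥0∞}
    (h : ∀ g : SimpleFunc M ℝ, B ≤ ∫⁻ w, ‖w.1.re - g w.2‖ₑ ^ 2 ∂(π ⊗ₘ κ)) :
    B ≤ avgPosteriorVariance κ π := by
  let g : M → ℝ := fun m => ∫ α, α.re ∂(posterior κ π m)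
  have hg : StronglyMeasurable g := Complex.measurable_re.stronglyMeasurable.integral_kernel
  have hgm := hg.measurable
  -- The average posterior variance is the mean square error of the posterior mean `g`.
  have e1 : avgPosteriorVariance κ π = ∫⁻ w, ‖w.1.re - g w.2‖ₑ ^ 2 ∂(π ⊗ₘ κ) :=
    lintegral_posterior κ π (f := fun w => ‖w.1.re - g w.2‖ₑ ^ 2) (by fun_prop)
  rw [e1]
  by_cases htop : ∫⁻ w, ‖w.1.re - g w.2‖ₑ ^ 2 ∂(π ⊗ₘ κ) = ∞
  · rw [htop]
    exact le_top
  have hX : MemLp (fun w : ℂ × M => w.1.re) 2 (π ⊗ₘ κ) := by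
    have hfst : MeasurePreserving Prod.fst (π ⊗ₘ κ) π := ⟨measurable_fst, Measure.fst_compProd π κ⟩
    exact hπ.comp_measurePreserving hfst
  have hsnd : MeasurePreserving Prod.snd (π ⊗ₘ κ) (π.bind κ) :=
    ⟨measurable_snd, Measure.snd_compProd π κ⟩
  have hXg : MemLp (fun w : ℂ × M => w.1.re - g w.2) 2 (π ⊗ₘ κ) := by
    refine ⟨Measurable.aestronglyMeasurable (by fun_prop), ?_⟩
    by_contra h6
    rw [not_lt, top_le_iff] at h6
    rw [← eLpNorm_two_sq, h6] at htop
    simp at htop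
  -- `g` is the difference of `Re α` and the error, both in L², so simple functions approximate it;
  -- Minkowski then transfers the bound on root mean square errors.
  have hg2 : MemLp g 2 (π.bind κ) := by
    have h1 : MemLp (fun w : ℂ × M => g w.2) 2 (π ⊗ₘ κ) := by
      have h2 : MemLp (fun w : ℂ × M => w.1.re - (w.1.re - g w.2)) 2 (π ⊗ₘ κ) := hX.sub hXg
      simpa using h2
    rw [← hsnd.map_eq]
    exact (memLp_map_measure_iff hg.aestronglyMeasurable measurable_snd.aemeasurable).2 h1
  have key : ∀ ε : ℝ≥0∞, ε ≠ 0 →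
      B ^ (1 / 2 : ℝ) ≤ eLpNorm (fun w : ℂ × M => w.1.re - g w.2) 2 (π ⊗ₘ κ) + ε := by
    intro ε hε
    obtain ⟨g', hg', -⟩ := hg2.exists_simpleFunc_eLpNorm_sub_lt (by norm_num) hε
    have h1 : B ^ (1 / 2 : ℝ) ≤ eLpNorm (fun w : ℂ × M => w.1.re - g' w.2) 2 (π ⊗ₘ κ) := by
      refine (ENNReal.rpow_le_rpow (h g') (by norm_num)).trans ?_
      rw [← eLpNorm_two_sq, ← ENNReal.rpow_ofNat, ← ENNReal.rpow_mul]
      norm_num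
    refine h1.trans ?_
    have h2 : (fun w : ℂ × M => w.1.re - g' w.2)
        = (fun w : ℂ × M => w.1.re - g w.2) + (g - ⇑g') ∘ Prod.snd := by
      ext w
      simp
    have h3 : eLpNorm ((g - ⇑g') ∘ Prod.snd) 2 (π ⊗ₘ κ) = eLpNorm (g - ⇑g') 2 (π.bind κ) :=
      eLpNorm_comp_measurePreserving (hgm.sub g'.measurable).aestronglyMeasurable hsnd
    rw [h2]
    refine (eLpNorm_add_le hXg.1 ((hgm.sub g'.measurable).comp
      measurable_snd).aestronglyMeasurable (by norm_num)).trans ?_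
    rw [h3]
    gcongr
  have h1 : B ^ (1 / 2 : ℝ) ≤ eLpNorm (fun w : ℂ × M => w.1.re - g w.2) 2 (π ⊗ₘ κ) :=
    ENNReal.le_of_forall_pos_le_add fun ε hε _ => key ε (by exact_mod_cast hε.ne')
  rw [← eLpNorm_two_sq]
  calc B = (B ^ (1 / 2 : ℝ)) ^ 2 := by
        rw [← ENNReal.rpow_ofNat, ← ENNReal.rpow_mul]; norm_num
    _ ≤ _ := by gcongr

end Bayes

lemma memLp_re_prior (μ₀ σ₀ : ℝ) (τ : Measure ℝ) [IsProbabilityMeasure τ] :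
    MemLp Complex.re 2 (prior μ₀ σ₀ τ) := by
  rw [prior, memLp_map_measure_iff Complex.measurable_re.aestronglyMeasurable (by fun_prop)]
  have h : MemLp (fun a : ℝ => a) 2 (gaussianReal μ₀ (σ₀ ^ 2).toNNReal) := memLp_id_gaussianReal 2
  exact h.comp_fst τ

lemma lintegral_prior (μ₀ σ₀ : ℝ) (τ : Measure ℝ) [IsProbabilityMeasure τ] {f : ℂ → ℝ≥0∞}
    (hf : Measurable f) : ∫⁻ α, f α ∂prior μ₀ σ₀ τ
      = ∫⁻ b, ∫⁻ a, f ⟨a, b⟩ ∂gaussianReal μ₀ (σ₀ ^ 2).toNNReal ∂τ := by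
  rw [prior, lintegral_map hf (by fun_prop), lintegral_prod_symm' (fun z => f (Complex.measurableEquivRealProd.symm z))
    (hf.comp (by fun_prop))]
  rfl

/-! ### The lower bound -/

section LowerBound

variable {M : Type*} [MeasurableSpace M] {E : POVM M} {ρ : Mode →L[ℂ] Mode} {c : ℂ}
  {hc : 0 < c.re} {ν : Measure ℝ} {q p : ℝ → ℝ}

/-- The outcome probabilities of a displaced mixture of pure Gaussian states. -/
lemma re_inner_displacement_gaussState (hc : 0 < c.re) (B : Mode →L[ℂ] Mode) (α : ℂ) (q p : ℝ) :
    (⟪displacement α (gaussState c hc q p), B (displacement α (gaussState c hc q p))⟫_ℂ).re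
      = (⟪gaussState c hc (q + √2 * α.re) (p + √2 * α.im),
          B (gaussState c hc (q + √2 * α.re) (p + √2 * α.im))⟫_ℂ).re := by
  obtain ⟨θ, hθ⟩ := displacement_gaussState hc α q p
  rw [hθ, map_smul, inner_smul_left, inner_smul_right, ← mul_assoc, ← Complex.normSq_eq_conj_mul_self,
    Complex.normSq_eq_norm_sq, Complex.norm_exp_ofReal_mul_I]
  simp

lemma stronglyMeasurable_displaced_gaussState (hc : 0 < c.re) (hq : Measurable q)
    (hp : Measurable p) : StronglyMeasurable fun z : ℂ × ℝ =>
      gaussState c hc (q z.2 + √2 * z.1.re) (p z.2 + √2 * z.1.im) :=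
  stronglyMeasurable_gaussState hc (by fun_prop) (by fun_prop)

/-- The label `s` of the pure component is drawn, the component is measured, and `s` is then
forgotten. Measurability in `α` comes from continuity of the Gaussian family. -/
lemma exists_isLikelihood [IsProbabilityMeasure ν] (E : POVM M) (hq : Measurable q)
    (hp : Measurable p) (h : IsMixture ρ ν fun s => gaussState c hc (q s) (p s)) :
    ∃ (κ : Kernel ℂ M) (_ : IsMarkovKernel κ), IsLikelihood E ρ κ := by
  let η := E.outcomeKernel (stronglyMeasurable_displaced_gaussState hc hq hp)
  have hη : IsMarkovKernel η := ⟨fun z => ⟨by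
    refine (E.outcome_univ _).trans ?_
    rw [norm_gaussState]
    simp⟩⟩
  refine ⟨Kernel.snd (Kernel.const ℂ ν ⊗ₖ η), inferInstance, h.isLikelihood _ fun α A hA => ?_⟩
  rw [Kernel.snd_apply' _ _ hA, Kernel.compProd_apply (measurable_snd hA), Kernel.const_apply]
  refine lintegral_congr fun s => ?_
  rw [re_inner_displacement_gaussState hc]
  exact E.outcome_apply hA _

/-- The expected square error of the estimate `g` of the value `a` in the pure state `ψ`. -/
def POVM.squareError (E : POVM M) (g : SimpleFunc M ℝ) (a : ℝ) (ψ : Mode) : ℝ≥0∞ :=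
  ∑ y : g.range, ENNReal.ofReal ((y - a) ^ 2) *
    ENNReal.ofReal (⟪ψ, E.effect (g ⁻¹' {(y : ℝ)}) ψ⟫_ℂ).re

lemma POVM.measurable_squareError {Y : Type*} [MeasurableSpace Y] (E : POVM M)
    (g : SimpleFunc M ℝ) {a : Y → ℝ} {χ : Y → Mode} (ha : Measurable a)
    (hχ : StronglyMeasurable χ) : Measurable fun z => E.squareError g (a z) (χ z) :=
  Finset.measurable_fun_sum _ fun y _ =>
    Measurable.mul (by fun_prop) (measurable_re_inner hχ _).ennreal_ofReal

lemma lintegral_sub_simpleFunc_sq (P : Measure M) (g : SimpleFunc M ℝ) (a : ℝ) :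
    ∫⁻ m, ‖a - g m‖ₑ ^ 2 ∂P
      = ∑ y : g.range, ENNReal.ofReal ((y - a) ^ 2) * P (g ⁻¹' {(y : ℝ)}) := by
  have h1 : ∀ m, ‖a - g m‖ₑ ^ 2 = (g.map fun y => ENNReal.ofReal ((y - a) ^ 2)) m := fun m => by
    rw [SimpleFunc.map_apply, ← enorm_pow, Real.enorm_of_nonneg (by positivity), sub_sq_comm]
  simp only [h1]
  rw [SimpleFunc.lintegral_eq_lintegral, SimpleFunc.map_lintegral,
    ← Finset.sum_coe_sort g.range]

lemma lintegral_bayes_bound {χ : ℝ → Mode} {F σ₀ : ℝ} (μ₀ : ℝ) (hσ₀ : 0 < σ₀) (hF : 0 ≤ F)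
    (hc : Continuous χ) (hn : ∀ a, ‖χ a‖ = 1)
    (hχ : ∀ a b, (⟪χ a, χ b⟫_ℂ).re = Real.exp (-(F / 8) * (a - b) ^ 2)) (g : SimpleFunc M ℝ) :
    ENNReal.ofReal (1 / σ₀ ^ 2 + F)⁻¹ ≤ ∫⁻ a, E.squareError g a (χ a)
      ∂gaussianReal μ₀ (σ₀ ^ 2).toNNReal := by
  have hv : (σ₀ ^ 2).toNNReal ≠ 0 := by
    have : 0 < σ₀ ^ 2 := by positivity
    simpa using this.ne'
  have hcv : (((σ₀ ^ 2).toNNReal : ℝ≥0) : ℝ) = σ₀ ^ 2 := Real.coe_toNNReal _ (by positivity)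
  have hE : ∀ y : g.range, MeasurableSet (g ⁻¹' {(y : ℝ)}) := fun y => g.measurableSet_fiber _
  have hb := bayes_bound_of_finite (μ := μ₀) (E := fun y : g.range => E.effect (g ⁻¹' {(y : ℝ)}))
    (fun y => E.isPositive _ (hE y)) (E.sum_effect_preimage g) (fun y => (y : ℝ)) hv hF hc hn hχ
  rw [hcv] at hb
  have hmeas : ∀ y : g.range, Measurable fun a =>
      ENNReal.ofReal (((y : ℝ) - a) ^ 2) *
        ENNReal.ofReal (⟪χ a, E.effect (g ⁻¹' {(y : ℝ)}) (χ a)⟫_ℂ).re := fun y =>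
    Measurable.mul (by fun_prop) (measurable_re_inner hc.stronglyMeasurable _).ennreal_ofReal
  simp only [POVM.squareError]
  rw [lintegral_finsetSum _ fun y _ => hmeas y]
  calc ENNReal.ofReal (1 / σ₀ ^ 2 + F)⁻¹
      ≤ ENNReal.ofReal (∑ y : g.range, ∫ a, ((y : ℝ) - a) ^ 2 *
          (⟪χ a, E.effect (g ⁻¹' {(y : ℝ)}) (χ a)⟫_ℂ).re
            ∂gaussianReal μ₀ (σ₀ ^ 2).toNNReal) := ENNReal.ofReal_le_ofReal hb
    _ ≤ ∑ y : g.range, ENNReal.ofReal (∫ a, ((y : ℝ) - a) ^ 2 *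
          (⟪χ a, E.effect (g ⁻¹' {(y : ℝ)}) (χ a)⟫_ℂ).re
            ∂gaussianReal μ₀ (σ₀ ^ 2).toNNReal) := by
        rw [ENNReal.ofReal_sum_of_nonneg]
        exact fun y _ => integral_nonneg fun a =>
          mul_nonneg (sq_nonneg _) (E.re_inner_nonneg (hE y) _)
    _ ≤ _ := by
        refine Finset.sum_le_sum fun y _ => ?_
        by_cases hi : Integrable (fun a => ((y : ℝ) - a) ^ 2 *
          (⟪χ a, E.effect (g ⁻¹' {(y : ℝ)}) (χ a)⟫_ℂ).re) (gaussianReal μ₀ (σ₀ ^ 2).toNNReal)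
        · rw [ofReal_integral_eq_lintegral_ofReal hi (Filter.Eventually.of_forall fun a =>
            mul_nonneg (sq_nonneg _) (E.re_inner_nonneg (hE y) _))]
          refine lintegral_mono fun a => ?_
          rw [ENNReal.ofReal_mul (sq_nonneg _)]
        -- A non-integrable term has Bochner integral `0`, so its contribution is bounded trivially.
        · rw [integral_undef hi]
          simp

/-- A change of `Re α` by `a` shifts the position by `√2 a`, so the overlap rate `|c|²/(4 Re c)`
doubles; equating it to `F/8` gives `F = 4 |c|²/Re c`. -/
lemma bayes_bound_gaussState (hc : 0 < c.re) {F σ₀ : ℝ} (μ₀ : ℝ) (hσ₀ : 0 < σ₀)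
    (hF : 4 * (Complex.normSq c / c.re) ≤ F) (g : SimpleFunc M ℝ) (q p : ℝ) :
    ENNReal.ofReal (1 / σ₀ ^ 2 + F)⁻¹ ≤ ∫⁻ a, E.squareError g a
      (gaussState c hc (q + √2 * a) p) ∂gaussianReal μ₀ (σ₀ ^ 2).toNNReal := by
  have hcont : Continuous fun a : ℝ => gaussState c hc (q + √2 * a) p := by
    have h1 : Continuous fun a : ℝ => (q + √2 * a, p) := by fun_prop
    have h2 := (continuous_gaussState hc).comp h1
    exact h2
  have hF0 : 0 ≤ 4 * (Complex.normSq c / c.re) := by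
    have := Complex.normSq_nonneg c
    positivity
  refine le_trans (ENNReal.ofReal_le_ofReal (inv_anti₀ (by positivity) (by linarith)))
    (lintegral_bayes_bound μ₀ hσ₀ hF0 hcont (fun a => norm_gaussState hc _ _) (fun a b => ?_) g)
  rw [inner_gaussState_same_momentum hc, Complex.ofReal_re]
  have h2 : √2 * √2 = 2 := Real.mul_self_sqrt (by norm_num)
  congr 1
  rw [mul_comm 4 c.re, ← div_div]
  linear_combination (-(Complex.normSq c / c.re / 4) * (a - b) ^ 2) * h2

/-- For a fixed simple estimator the error is an average over the component `s` and over `Im α`.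
With both fixed, only the position of one pure Gaussian state varies, and the pure-state bound
applies; knowledge of `s` or `Im α` cannot beat it. -/
lemma IsLikelihood.le_avgPosteriorVariance {κ : Kernel ℂ M} [IsMarkovKernel κ]
    [IsProbabilityMeasure ν] (hκ : IsLikelihood E ρ κ)
    (hq : Measurable q) (hp : Measurable p)
    (h : IsMixture ρ ν fun s => gaussState c hc (q s) (p s)) {F σ₀ : ℝ} (hσ₀ : 0 < σ₀)
    (hF : 4 * (Complex.normSq c / c.re) ≤ F) (μ₀ : ℝ) (τ : Measure ℝ) [IsProbabilityMeasure τ] :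
    ENNReal.ofReal (1 / σ₀ ^ 2 + F)⁻¹ ≤ avgPosteriorVariance κ (prior μ₀ σ₀ τ) := by
  refine BosonicMode.le_avgPosteriorVariance κ _ (memLp_re_prior μ₀ σ₀ τ) fun g => ?_
  have hχ := stronglyMeasurable_displaced_gaussState hc hq hp
  have hG : Measurable (Function.uncurry fun (α : ℂ) (s : ℝ) => E.squareError g α.re
      (gaussState c hc (q s + √2 * α.re) (p s + √2 * α.im))) :=
    E.measurable_squareError g (by fun_prop) hχ
  have hm : ∀ (α : ℂ) (y : g.range), Measurable fun s =>
      ENNReal.ofReal (⟪gaussState c hc (q s + √2 * α.re) (p s + √2 * α.im),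
        E.effect (g ⁻¹' {(y : ℝ)})
          (gaussState c hc (q s + √2 * α.re) (p s + √2 * α.im))⟫_ℂ).re := fun α y =>
    (measurable_re_inner (stronglyMeasurable_gaussState hc (by fun_prop) (by fun_prop))
      _).ennreal_ofReal
  have e1 : ∀ α : ℂ, ∫⁻ m, ‖α.re - g m‖ₑ ^ 2 ∂κ α = ∫⁻ s, E.squareError g α.re
      (gaussState c hc (q s + √2 * α.re) (p s + √2 * α.im)) ∂ν := fun α => by
    simp only [POVM.squareError]
    rw [lintegral_sub_simpleFunc_sq, lintegral_finsetSum _ fun y _ => (hm α y).const_mul _]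
    refine Finset.sum_congr rfl fun y _ => ?_
    rw [lintegral_const_mul _ (hm α y), hκ.apply h α (g.measurableSet_fiber _)]
    simp only [re_inner_displacement_gaussState hc]
  rw [Measure.lintegral_compProd (f := fun w : ℂ × M => ‖w.1.re - g w.2‖ₑ ^ 2)
    (by have := g.measurable; fun_prop)]
  simp only [e1]
  rw [lintegral_lintegral_swap hG.aemeasurable]
  have e2 : ∀ s, ENNReal.ofReal (1 / σ₀ ^ 2 + F)⁻¹ ≤ ∫⁻ α, E.squareError g α.re
      (gaussState c hc (q s + √2 * α.re) (p s + √2 * α.im)) ∂prior μ₀ σ₀ τ := fun s => by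
    rw [lintegral_prior μ₀ σ₀ τ (f := fun α => E.squareError g α.re
      (gaussState c hc (q s + √2 * α.re) (p s + √2 * α.im)))
      (E.measurable_squareError g (by fun_prop)
        (stronglyMeasurable_gaussState hc (by fun_prop) (by fun_prop)))]
    calc _ = ∫⁻ _ : ℝ, ENNReal.ofReal (1 / σ₀ ^ 2 + F)⁻¹ ∂τ := by simp
      _ ≤ _ := lintegral_mono fun b => bayes_bound_gaussState hc μ₀ hσ₀ hF g (q s) (p s + √2 * b)
  calc _ = ∫⁻ _ : ℝ, ENNReal.ofReal (1 / σ₀ ^ 2 + F)⁻¹ ∂ν := by simp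
    _ ≤ _ := lintegral_mono e2

end LowerBound

/-! ### Homodyne detection of a displaced squeezed vacuum -/

lemma normSq_gaussWave {c : ℂ} (hc : 0 < c.re) {v : ℝ≥0} (hv : (v : ℝ) = 1 / (2 * c.re))
    (q p x : ℝ) : ‖gaussWave c q p x‖ ^ 2 = gaussianPDFReal q v x := by
  have h := gaussWave_mul_conj hc q p q p x x
  rw [Complex.mul_conj, Complex.normSq_eq_norm_sq] at h
  have hcj : (starRingEnd ℂ) c = 2 * c.re - c := by
    have := Complex.add_conj c
    push_cast at this
    linear_combination this
  have h1 : -c * ((x : ℂ) - q) ^ 2 / 2 + p * x * Complex.I +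
        (-(starRingEnd ℂ) c * (x - q) ^ 2 / 2 - p * x * Complex.I)
      = ((-c.re * (x - q) ^ 2 : ℝ) : ℂ) := by
    rw [hcj]
    push_cast
    ring
  rw [h1, ← Complex.ofReal_exp, ← Complex.ofReal_mul] at h
  rw [Complex.ofReal_injective h, gaussianPDFReal, hv, ← Real.sqrt_inv]
  congr 2
  · field_simp
  · field_simp

lemma re_inner_homodyne_gaussState {c : ℂ} (hc : 0 < c.re) {v : ℝ≥0}
    (hv : (v : ℝ) = 1 / (2 * c.re)) (q p : ℝ) {A : Set ℝ} (hA : MeasurableSet A) :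
    ENNReal.ofReal (⟪gaussState c hc q p, homodyne.effect A (gaussState c hc q p)⟫_ℂ).re
      = gaussianReal q v A := by
  have hv0 : v ≠ 0 := by
    intro h
    rw [h] at hv
    have : 0 < 1 / (2 * c.re) := by positivity
    simp at hv
    exact hc.ne' hv
  have h1 : homodyne.effect A = positionProj A hA := dif_pos hA
  rw [h1, inner_positionProj, gaussianReal_apply_eq_integral q hv0]
  congr 1
  have h2 : ∫ x in A, ⟪(gaussState c hc q p : ℝ → ℂ) x, (gaussState c hc q p : ℝ → ℂ) x⟫_ℂ
      = ((∫ x in A, gaussianPDFReal q v x : ℝ) : ℂ) := by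
    rw [← integral_complex_ofReal]
    refine integral_congr_ae (ae_restrict_of_ae ?_)
    filter_upwards [gaussState_coeFn hc q p] with x hx
    rw [hx, inner_self_eq_norm_sq_to_K, ← normSq_gaussWave hc hv q p]
    push_cast
    rfl
  rw [h2, Complex.ofReal_re]

/-- The likelihood of homodyne detection: normally distributed with mean `√2 Re α`. -/
def homodyneKernel (v : ℝ≥0) : Kernel ℂ ℝ where
  toFun α := gaussianReal (√2 * α.re) v
  measurable' := measurable_gaussianReal.comp
    (by fun_prop : Measurable fun α : ℂ => (√2 * α.re, v))

instance (v : ℝ≥0) : IsMarkovKernel (homodyneKernel v) :=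
  ⟨fun α => by change IsProbabilityMeasure (gaussianReal _ _); infer_instance⟩

lemma isLikelihood_homodyneKernel (r : ℝ) {v : ℝ≥0} (hv : (v : ℝ) = Real.exp (-(2 * r)) / 2) :
    IsLikelihood homodyne (squeezedVacuum r) (homodyneKernel v) := by
  have h : 0 < (((Real.exp (2 * r) : ℝ) : ℂ)).re := Real.exp_pos _
  refine (isMixture_squeezedVacuum r h).isLikelihood _ fun α A hA => ?_
  rw [lintegral_dirac, re_inner_displacement_gaussState, re_inner_homodyne_gaussState h _ _ _ hA,
    zero_add]
  · rfl
  · rw [hv, Complex.ofReal_re, Real.exp_neg]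
    field_simp

lemma lintegral_affine_sq_gaussianReal (A B μ : ℝ) (v : ℝ≥0) :
    ∫⁻ x, ‖A + B * x‖ₑ ^ 2 ∂gaussianReal μ v = ENNReal.ofReal ((A + B * μ) ^ 2 + B ^ 2 * v) := by
  have hid : MemLp (fun x : ℝ => x) 2 (gaussianReal μ v) := memLp_id_gaussianReal 2
  have hB : MemLp (fun x : ℝ => B * x) 2 (gaussianReal μ v) := hid.const_mul B
  have h : MemLp (fun x : ℝ => A + B * x) 2 (gaussianReal μ v) := (memLp_const A).add hB
  have h1 := variance_eq_sub h
  rw [variance_const_add hB.1, variance_const_mul, variance_fun_id_gaussianReal,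
    integral_add (integrable_const A) (hB.integrable (by norm_num)), integral_const_mul,
    integral_id_gaussianReal] at h1
  have h2 : ∫ x, (A + B * x) ^ 2 ∂gaussianReal μ v = (A + B * μ) ^ 2 + B ^ 2 * v := by
    simp only [Pi.pow_apply, integral_const, probReal_univ, one_smul] at h1
    linarith
  rw [← h2, ofReal_integral_eq_lintegral_ofReal h.integrable_sq
    (Filter.Eventually.of_forall fun _ => sq_nonneg _)]
  refine lintegral_congr fun x => ?_
  rw [← enorm_pow, Real.enorm_of_nonneg (sq_nonneg _)]

lemma avgPosteriorVariance_homodyneKernel_le (μ₀ : ℝ) {σ₀ r : ℝ} (hσ₀ : 0 < σ₀) (τ : Measure ℝ)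
    [IsProbabilityMeasure τ] {v : ℝ≥0} (hv : (v : ℝ) = Real.exp (-(2 * r)) / 2) :
    avgPosteriorVariance (homodyneKernel v) (prior μ₀ σ₀ τ)
      ≤ ENNReal.ofReal (1 / σ₀ ^ 2 + 4 * Real.exp (2 * r))⁻¹ := by
  have hcv : (((σ₀ ^ 2).toNNReal : ℝ≥0) : ℝ) = σ₀ ^ 2 := Real.coe_toNNReal _ (by positivity)
  -- The weight of the rescaled outcome `m/√2` is its share of the total information. The error of
  -- the linear estimator is `(1-k)² σ₀² + k² v/2` with `v/2 = exp (-2r)/4`.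
  set k : ℝ := 4 * Real.exp (2 * r) / (1 / σ₀ ^ 2 + 4 * Real.exp (2 * r)) with hk
  have hs : √2 ≠ 0 := by positivity
  have hs2 : √2 ^ 2 = 2 := Real.sq_sqrt (by norm_num)
  refine (avgPosteriorVariance_le _ _
    (g := fun m => (1 - k) * μ₀ + k / √2 * m) (by fun_prop)).trans (le_of_eq ?_)
  rw [Measure.lintegral_compProd (by fun_prop)]
  have e1 : ∀ α : ℂ, ∫⁻ m, ‖α.re - ((1 - k) * μ₀ + k / √2 * m)‖ₑ ^ 2 ∂homodyneKernel v α
      = ‖-((1 - k) * μ₀) + (1 - k) * α.re‖ₑ ^ 2 + ENNReal.ofReal (k ^ 2 / 2 * v) := fun α => by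
    have h1 := lintegral_affine_sq_gaussianReal (α.re - (1 - k) * μ₀) (-(k / √2)) (√2 * α.re) v
    rw [← enorm_pow, Real.enorm_of_nonneg (sq_nonneg _),
      ← ENNReal.ofReal_add (sq_nonneg _) (by positivity)]
    refine Eq.trans ?_ (h1.trans ?_)
    · refine lintegral_congr fun m => ?_
      congr 2
      ring
    · congr 1
      have h2 : -(k / √2) * (√2 * α.re) = -(k * α.re) := by field_simp
      rw [h2, neg_sq, div_pow, hs2]
      ring
  simp only [e1]
  rw [lintegral_prior μ₀ σ₀ τ (f := fun α => ‖-((1 - k) * μ₀) + (1 - k) * α.re‖ₑ ^ 2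
    + ENNReal.ofReal (k ^ 2 / 2 * v)) (by fun_prop)]
  simp only [lintegral_add_right _ measurable_const, lintegral_affine_sq_gaussianReal,
    lintegral_const, measure_univ, mul_one]
  rw [← ENNReal.ofReal_add (by positivity) (by positivity), hcv, hv]
  congr 1
  have he : 0 < Real.exp (2 * r) := Real.exp_pos _
  rw [Real.exp_neg]
  generalize Real.exp (2 * r) = e at *
  rw [hk]
  field_simp
  ring

end BosonicMode

end

/-! ### Lower bound and attainment combined -/

theorem mainTheorem4 (μ₀ σ₀ r : ℝ) (hσ₀ : 0 < σ₀) (τ : Measure ℝ) [IsProbabilityMeasure τ] :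
    (∀ (M : Type*) [MeasurableSpace M] (E : BosonicMode.POVM M)
        (ρ : BosonicMode.Mode →L[ℂ] BosonicMode.Mode) (m : Fin 2 → ℝ) (φ n : ℝ),
        (0 ≤ r ∨ φ = 0) → 0 ≤ n →
        BosonicMode.IsGaussianState ρ m (BosonicMode.squeezedCov r φ n) →
        ∃ (κ : Kernel ℂ M) (_ : IsMarkovKernel κ), BosonicMode.IsLikelihood E ρ κ ∧
          ENNReal.ofReal (1 / σ₀ ^ 2 + 4 * Real.exp (2 * r))⁻¹ ≤
            BosonicMode.avgPosteriorVariance κ (BosonicMode.prior μ₀ σ₀ τ)) ∧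
    (BosonicMode.IsGaussianState (BosonicMode.squeezedVacuum r) 0
        (BosonicMode.squeezedCov r 0 0) ∧
      ∃ (κ : Kernel ℂ ℝ) (_ : IsMarkovKernel κ),
        BosonicMode.IsLikelihood BosonicMode.homodyne (BosonicMode.squeezedVacuum r) κ ∧
          BosonicMode.avgPosteriorVariance κ (BosonicMode.prior μ₀ σ₀ τ) =
            ENNReal.ofReal (1 / σ₀ ^ 2 + 4 * Real.exp (2 * r))⁻¹) := by
  have hF : ∀ {φ n : ℝ} {c : ℂ}, (0 ≤ r ∨ φ = 0) → 0 ≤ n → Complex.normSq c / c.re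
      = (Real.cosh (2 * r) + Real.cos φ * Real.sinh (2 * r)) / (2 * n + 1) →
      4 * (Complex.normSq c / c.re) ≤ 4 * Real.exp (2 * r) := by
    intro φ n c hrφ hn hc
    rw [hc]
    have h1 := (div_le_self (BosonicMode.squeezedCov_apply_one_one_pos r φ).le
      (by linarith : 1 ≤ 2 * n + 1)).trans (BosonicMode.squeezedCov_apply_one_one_le hrφ)
    linarith
  refine ⟨fun M _ E ρ m φ n hrφ hn hρ => ?_, BosonicMode.isGaussianState_squeezedVacuum r, ?_⟩
  · obtain ⟨c, hc, b, v, hcF, hmix⟩ := hρ.exists_isMixture hn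
    have hq : Measurable fun s => m 0 + b * s := by fun_prop
    have hp : Measurable fun s => m 1 + s := by fun_prop
    obtain ⟨κ, hκ, hlik⟩ := BosonicMode.exists_isLikelihood E hq hp hmix
    exact ⟨κ, hκ, hlik, hlik.le_avgPosteriorVariance hq hp hmix hσ₀ (hF hrφ hn hcF) μ₀ τ⟩
  · obtain ⟨v, hv⟩ : ∃ v : ℝ≥0, (v : ℝ) = Real.exp (-(2 * r)) / 2 :=
      ⟨⟨_, by positivity⟩, rfl⟩
    have hlik := BosonicMode.isLikelihood_homodyneKernel r hv
    -- The squeezed vacuum falls under the lower bound with `φ = 0`, so optimality of the linear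
    -- estimator need not be proved separately, for either sign of `r`.
    obtain ⟨c, hc, b, w, hcF, hmix⟩ := (BosonicMode.isGaussianState_squeezedVacuum r).exists_isMixture le_rfl
    exact ⟨BosonicMode.homodyneKernel v, inferInstance, hlik,
      le_antisymm (BosonicMode.avgPosteriorVariance_homodyneKernel_le μ₀ hσ₀ τ hv)
        (hlik.le_avgPosteriorVariance (q := fun s => (0 : Fin 2 → ℝ) 0 + b * s)
          (p := fun s => (0 : Fin 2 → ℝ) 1 + s) (by fun_prop) (by fun_prop) hmix hσ₀
          (hF (Or.inr rfl) le_rfl hcF) μ₀ τ)⟩
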